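/- Let $n$ be a natural number and $W=\mathbb{C}^n$ with standard basis $w_1,\dots,w_n$. All pairs $(i,j)$ below satisfy $1\le i\le j\le n-1$. Put $S_{i,j}=\{1,\dots,i,j+1,\dots,n\}$, $W_{i,j}=\mathrm{span}(w_s : s\in S_{i,j})$, and let $pr_k:W\to W$ be the projection with $pr_kw_k=0$ and $pr_kw_l=w_l$ for $l\ne k$. Let $R_n$ be the set of collections $(V_{i,j})$ of subspaces of $W$ with $\dim V_{i,j}=i$ and $V_{i,j}\subset W_{i,j}$, with $V_{i,j}\subset V_{i+1,j}$ for $i<j$, and with $pr_{j+1}V_{i,j}\subset V_{i,j+1}$ for $j<n-1$. It is embedded into $\prod_{(i,j)}\mathbb{P}(\Lambda^iW_{i,j})$ by Plücker coordinates. Let $\mathbb{C}\mathbf{X}_n$ be the polynomial ring in the Plücker coordinates $X^{(i,j)}_{l_1,\dots,l_i}$, where $l_1<\dots<l_i$ are elements of $S_{i,j}$. For an arbitrary sequence $L=(l_1,\dots,l_i)$ the symbol $X^{(i,j)}_L$ is defined by antisymmetry in the indices; it is $0$ if an index repeats or some index is not in $S_{i,j}$. A polynomial is multi-homogeneous if,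 for each $(i,j)$, all its monomials have the same total degree in the variables $X^{(i,j)}_L$. Let $I(R_n)$ be the ideal generated by the multi-homogeneous polynomials that vanish on $R_n$. Let $J_n\subset\mathbb{C}\mathbf{X}_n$ be the ideal generated by the generalized Plücker relations $$R^{(i_1,j_1),(i_2,j_2);k}_{L,P}=\varepsilon\, X^{(i_1,j_1)}_LX^{(i_2,j_2)}_P-\sum_{r_1<\dots<r_k}X^{(i_1,j_1)}_{L'}X^{(i_2,j_2)}_{P'},$$ where $i_1\ge i_2$ and $1\le k\le i_2$; $L=(l_1,\dots,l_{i_1})$ and $P=(p_1,\dots,p_{i_2})$ are sequences of distinct elements of $S_{i_1,j_1}$ and $S_{i_2,j_2}$; and either $i_1\neq i_2$ and $j_1\ge j_2$, or $j_1\le j_2$ and $L\subset\{1,\dots,i_1,j_2+1,\dots,n\}$. The sum is over the increasing sequences of positions $1\le r_1<\dots<r_k\le i_1$ with all $l_{r_t}\in\{1,\dots,i_2,j_1+1,\dots,n\}$. The sequence $L'$ is obtained from $L$ by replacing $l_{r_t}$ by $p_t$ for $t=1,\dots,k$, and $P'=(l_{r_1},\dots,l_{r_k},p_{k+1},\dots,p_{i_2})$.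 Finally $\varepsilon=1$ if $\{p_1,\dots,p_k\}\subset\{1,\dots,i_2,j_1+1,\dots,n\}$, and $\varepsilon=0$ otherwise. The abelian Lie algebra $(\mathfrak{n}^-)^a$ with basis $f_{a,b}$, $1\le a\le b\le n-1$, acts on $\mathbb{C}\mathbf{X}_n$ by derivations. For $l_1<\dots<l_i$ in $S_{i,j}$, $$f_{a,b}X^{(i,j)}_{l_1,\dots,l_i}=-X^{(i,j)}_{l_1,\dots,l_{r-1},a,l_{r+1},\dots,l_i}\quad\text{if } a\le i\le j\le b \text{ and } l_r=b+1,$$ and $f_{a,b}X^{(i,j)}_{l_1,\dots,l_i}=0$ otherwise. **Theorem.** The ideal $I(R_n)$ is the saturation of $J_n$ with respect to the variables $X^{(i,j)}_{1,\dots,i}$: for $F\in\mathbb{C}\mathbf{X}_n$, one has $F\in I(R_n)$ if and only if there are non-negative integers $N_{i,j}$ with $$\prod_{i\le j}\bigl(X^{(i,j)}_{1,\dots,i}\bigr)^{N_{i,j}}F\in J_n.$$ Moreover, $I(R_n)$ is invariant under the action of $(\mathfrak{n}^-)^a$. -/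

import Mathlib

open scoped BigOperators

noncomputable section

namespace DegenerateFlag

/-- The positive roots `α_{i,j}`, `1 ≤ i ≤ j ≤ n - 1`, of `sl_n`, as pairs `(i, j)`. -/
abbrev PosRoot (n : ℕ) : Type := {p : Fin n × Fin n // 1 ≤ p.1.val ∧ p.1 ≤ p.2}

/-- The number `i` of the root `α_{i,j}`. -/
def PosRoot.i {n : ℕ} (r : PosRoot n) : ℕ := r.1.1.val

/-- The number `j` of the root `α_{i,j}`. -/
def PosRoot.j {n : ℕ} (r : PosRoot n) : ℕ := r.1.2.val

theorem PosRoot.i_pos {n : ℕ} (r : PosRoot n) : 1 ≤ r.i := r.2.1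

theorem PosRoot.i_le_j {n : ℕ} (r : PosRoot n) : r.i ≤ r.j := r.2.2

theorem PosRoot.j_lt {n : ℕ} (r : PosRoot n) : r.j < n := r.1.2.isLt

theorem PosRoot.i_le {n : ℕ} (r : PosRoot n) : r.i ≤ n := r.1.1.isLt.le

/-- The space `W = ℂⁿ`. The basis vector `w_{x+1}` is the standard basis vector with index
`x : Fin n`: all indices of basis vectors are shifted by one. -/
abbrev W (n : ℕ) : Type := Fin n → ℂ

/-- `InRange i j x`: the (one-based) index `x + 1` belongs to `{1, …, i, j + 1, …, n}`. -/
def InRange {n : ℕ} (i j : ℕ) (x : Fin n) : Prop := x.val < i ∨ j ≤ x.val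

/-- The coordinate subspace `W_{i,j} = span (w_1, …, w_i, w_{j+1}, …, w_n)`. -/
def coordSubspace {n : ℕ} (r : PosRoot n) : Submodule ℂ (W n) :=
  Submodule.span ℂ {w | ∃ x : Fin n, InRange r.i r.j x ∧ w = Pi.single x 1}

/-- The projection of `W` along the basis vector with index `k`. -/
def proj {n : ℕ} (k : Fin n) : W n →ₗ[ℂ] W n where
  toFun w := Function.update w k 0
  map_add' v w := by
    ext x
    by_cases h : x = k
    · subst h; simp
    · simp [h]
  map_smul' c w := by
    ext x
    by_cases h : x = k
    · subst h; simp
    · simp [h]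

/-- The variety `R_n`, as the set of collections `(V_{i,j})` of subspaces of `W` such that
`dim V_{i,j} = i`, `V_{i,j} ⊆ W_{i,j}`, `V_{i,j} ⊆ V_{i+1,j}` and
`pr_{j+1} V_{i,j} ⊆ V_{i,j+1}`. -/
def Rn (n : ℕ) : Set (PosRoot n → Submodule ℂ (W n)) :=
  {V | (∀ r, Module.finrank ℂ (V r) = r.i ∧ V r ≤ coordSubspace r) ∧
    (∀ r s : PosRoot n, s.i = r.i + 1 → s.j = r.j → V r ≤ V s) ∧
    (∀ r s : PosRoot n, s.i = r.i → s.j = r.j + 1 →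
      (V r).map (proj ⟨r.j, r.j_lt⟩) ≤ V s)}

/-- The labels of the variables `X_L^{(i,j)}`: a root `(i, j)` and an increasing sequence
`L = (l_1 < … < l_i)` in `{1, …, i, j + 1, …, n}`. -/
abbrev PluckerVar (n : ℕ) : Type :=
  Σ r : PosRoot n, {L : Fin r.i → Fin n // StrictMono L ∧ ∀ a, InRange r.i r.j (L a)}

/-- The ring `ℂX_n` of polynomials in the Plücker variables. -/
abbrev PolyRing (n : ℕ) : Type := MvPolynomial (PluckerVar n) ℂ

open Classical in
/-- The element `X_l^{(i,j)}` for an arbitrary sequence of indices `l = (l_1, …, l_i)`: the variable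
of the sorted sequence times the sign of the sorting permutation. It is zero if an index repeats or
if one of them is outside `{1, …, i, j + 1, …, n}`. -/
def X {n : ℕ} (r : PosRoot n) (l : Fin r.i → Fin n) : PolyRing n :=
  if h : Function.Injective l ∧ ∀ a, InRange r.i r.j (l a) then
    ((Equiv.Perm.sign (Tuple.sort l) : ℤ) : PolyRing n) *
      MvPolynomial.X ⟨r, l ∘ Tuple.sort l,
        (Tuple.monotone_sort l).strictMono_of_injective
          (h.1.comp (Tuple.sort l).injective), fun _ => h.2 _⟩
  else 0

/-- The variable `X_{1,…,i}^{(i,j)}`. -/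
def topX {n : ℕ} (r : PosRoot n) : PolyRing n := X r (Fin.castLE r.i_le)

/-- `F` is multi-homogeneous of multi-degree `m`: each of its monomials has total degree `m_{i,j}`
in the variables `X_L^{(i,j)}`, for every `(i, j)`. -/
def IsMultihomogeneous {n : ℕ} (F : PolyRing n) (m : PosRoot n → ℕ) : Prop :=
  MvPolynomial.IsWeightedHomogeneous
    (fun x : PluckerVar n => (Pi.single x.1 1 : PosRoot n → ℕ)) F m

/-- `v r` is a basis of the subspace `V r`, for every root `r`. -/
def IsBasisFamily {n : ℕ} (V : PosRoot n → Submodule ℂ (W n))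
    (v : (r : PosRoot n) → Fin r.i → W n) : Prop :=
  ∀ r, LinearIndependent ℂ (v r) ∧ Submodule.span ℂ (Set.range (v r)) = V r

/-- The Plücker coordinates of a collection of subspaces with respect to bases of the subspaces:
`X_L^{(i,j)}` takes the value of the minor with columns `L` of the matrix of the basis of
`V_{i,j}`, i.e. the coefficient of `w_{l_1} ∧ … ∧ w_{l_i}` in the product of the basis vectors. -/
def pluckerCoord {n : ℕ} (v : (r : PosRoot n) → Fin r.i → W n) (x : PluckerVar n) : ℂ :=
  (Matrix.of fun a b : Fin x.1.i => v x.1 a (x.2.1 b)).det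

/-- `F` vanishes on `R_n` (embedded into the product of the projective spaces `ℙ(Λ^i W_{i,j})`):
it vanishes at all the homogeneous coordinates of all the points of `R_n`. -/
def VanishesOnRn {n : ℕ} (F : PolyRing n) : Prop :=
  ∀ V ∈ Rn n, ∀ v, IsBasisFamily V v → MvPolynomial.eval (pluckerCoord v) F = 0

/-- The ideal `I(R_n)` of (sums of) multi-homogeneous polynomials vanishing on `R_n`. -/
def vanishingIdeal (n : ℕ) : Ideal (PolyRing n) :=
  Ideal.span {F | (∃ m, IsMultihomogeneous F m) ∧ VanishesOnRn F}

open Classical in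
/-- The generalized Plücker relation `R_{L,P}^{(i₁,j₁),(i₂,j₂);k}`. The sum is over the increasing
sequences `ρ` of `k` positions in `L` with all `l_{ρ_t}` in `{1, …, i₂, j₁ + 1, …, n}`; the sequence
`L'` is `L` with `l_{ρ_t}` replaced by `p_t`, and `P'` is `P` with `p_t` replaced by `l_{ρ_t}`,
`t = 1, …, k`. The initial term `X_L X_P` is present only if all of `p_1, …, p_k` belong to
`{1, …, i₂, j₁ + 1, …, n}`. -/
def pluckerRelation {n : ℕ} (r₁ r₂ : PosRoot n) (k : ℕ) (hk : k ≤ r₂.i)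
    (L : Fin r₁.i → Fin n) (P : Fin r₂.i → Fin n) : PolyRing n :=
  (if ∀ t : Fin k, InRange r₂.i r₁.j (P (Fin.castLE hk t)) then X r₁ L * X r₂ P else 0) -
    ∑ ρ : Fin k → Fin r₁.i,
      if StrictMono ρ ∧ ∀ t, InRange r₂.i r₁.j (L (ρ t)) then
        X r₁ (Function.extend ρ (fun t => P (Fin.castLE hk t)) L) *
          X r₂ (fun b => if h : b.val < k then L (ρ ⟨b.val, h⟩) else P b)
      else 0

/-- The admissible data for the Plücker relations: `i₁ ≥ i₂`, `1 ≤ k ≤ i₂`, sequences `L` and `P` of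
distinct indices in `{1, …, i₁, j₁ + 1, …, n}` and `{1, …, i₂, j₂ + 1, …, n}`, and either
`i₁ ≠ i₂`, `j₁ ≥ j₂`, or `j₁ ≤ j₂` and `L ⊆ {1, …, i₁, j₂ + 1, …, n}`. -/
def IsAdmissible {n : ℕ} (r₁ r₂ : PosRoot n) (k : ℕ)
    (L : Fin r₁.i → Fin n) (P : Fin r₂.i → Fin n) : Prop :=
  r₂.i ≤ r₁.i ∧ 1 ≤ k ∧
    Function.Injective L ∧ (∀ a, InRange r₁.i r₁.j (L a)) ∧
    Function.Injective P ∧ (∀ b, InRange r₂.i r₂.j (P b)) ∧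
    ((r₁.i ≠ r₂.i ∧ r₂.j ≤ r₁.j) ∨ (r₁.j ≤ r₂.j ∧ ∀ a, InRange r₁.i r₂.j (L a)))

/-- The ideal `J_n` generated by the generalized Plücker relations. -/
def pluckerIdeal (n : ℕ) : Ideal (PolyRing n) :=
  Ideal.span {R | ∃ (r₁ r₂ : PosRoot n) (k : ℕ) (hk : k ≤ r₂.i)
    (L : Fin r₁.i → Fin n) (P : Fin r₂.i → Fin n),
    IsAdmissible r₁ r₂ k L P ∧ R = pluckerRelation r₁ r₂ k hk L P}

/-- The index `a` of the root `α_{a,b}` as an index of a basis vector: that of `w_a`. -/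
def PosRoot.source {n : ℕ} (s : PosRoot n) : Fin n :=
  ⟨s.i - 1, lt_of_le_of_lt (Nat.sub_le _ _) s.1.1.isLt⟩

/-- The index of the basis vector `w_{b+1}`, for the root `α_{a,b}`. -/
def PosRoot.target {n : ℕ} (s : PosRoot n) : Fin n := ⟨s.j, s.j_lt⟩

/-- The value of `f_{a,b}` on the variable `X_L^{(i,j)}`: it is
`- X_{l_1, …, l_{t-1}, a, l_{t+1}, …, l_i}^{(i,j)}` if `a ≤ i ≤ j ≤ b` and `l_t = b + 1`, and zero
if `a ≤ i ≤ j ≤ b` does not hold or `b + 1` is not in `L`. -/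
def rootActVar {n : ℕ} (s : PosRoot n) (x : PluckerVar n) : PolyRing n :=
  if s.i ≤ x.1.i ∧ x.1.j ≤ s.j then
    -∑ t : Fin x.1.i,
      if x.2.1 t = s.target then X x.1 (Function.update x.2.1 t s.source) else 0
  else 0

/-- The action of `f_{a,b}` on `ℂX_n` by a derivation. -/
def rootAct {n : ℕ} (s : PosRoot n) : Derivation ℂ (PolyRing n) (PolyRing n) :=
  MvPolynomial.mkDerivation ℂ (rootActVar s)

/-- The abelian Lie algebra `(𝔫⁻)ᵃ`, in coordinates with respect to its basis `f_{a,b}`. -/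
abbrev NMinus (n : ℕ) : Type := PosRoot n → ℂ

/-- The action of `(𝔫⁻)ᵃ` on `ℂX_n`: the element `∑ c_{a,b} f_{a,b}` acts by `∑ c_{a,b} f_{a,b}`. -/
def nMinusAct {n : ℕ} (c : NMinus n) : Derivation ℂ (PolyRing n) (PolyRing n) :=
  ∑ s, c s • rootAct s

end DegenerateFlag

end

/-! Both `vanishingIdeal n` and the saturation of `pluckerIdeal n` are shown to equal the kernel of
one homomorphism, `genericHom`. It evaluates at the generic point of the open cell of `R_n`, where
all largest coordinates are nonzero, with an independent scaling in each projective factor. A point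
of the cell is a family of numbers c_{a,x} shared by all components: V_{i,j} is spanned by the
vectors w_a + ∑_{x>j} c_{a,x} w_x with a ≤ i.

Kernel and saturation. The Plücker relations vanish on the cell because they are instances of a
determinantal exchange identity (`det_mul_alternating`, `cellHom_pluckerRelation`). The largest
coordinates go to nonzero elements of a domain, so the whole saturation lies in the kernel.
Conversely, once the largest coordinates are inverted modulo the relations, the relations with k = 1
and L = (1, …, i) express every coordinate through ratios c_{a,x}. The tautological homomorphism to
this localization is therefore evaluation at a point of the cell (`exists_cellHom`), and it kills
everything in the kernel of `genericHom`.

Kernel and vanishing ideal. The cell lies in `R_n`, and the kernel is multigraded because of the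
scalings. What remains is density of the cell: each point of `R_n` is joined to the standard
coordinate point of the cell by a polynomial curve (`exists_curve`). A multi-homogeneous polynomial
vanishing on the cell vanishes at all but finitely many points of that curve, hence at all of them
(`vanishesOnRn_of_genericHom`).

Invariance. The vector f_{a,b} acts as the infinitesimal translation of one cell coordinate, which
preserves the kernel; dual numbers make this exact (`cellHom_dualNumber`). -/

noncomputable section

namespace DegenerateFlag

/-! ### Antisymmetry of the Plücker variables. -/

section Antisymmetry

variable {n : ℕ}

theorem X_eq_zero {r : PosRoot n} {l : Fin r.i → Fin n}
    (h : ¬(Function.Injective l ∧ ∀ a, InRange r.i r.j (l a))) : X r l = 0 := by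
  rw [X, dif_neg h]

theorem X_of_strictMono (r : PosRoot n) (l : Fin r.i → Fin n)
    (h : StrictMono l ∧ ∀ a, InRange r.i r.j (l a)) :
    X r l = MvPolynomial.X ⟨r, l, h⟩ := by
  have hs : Tuple.sort l = Equiv.refl _ := Tuple.sort_eq_refl_iff_monotone.2 h.1.monotone
  rw [X, dif_pos ⟨h.1.injective, h.2⟩]
  have h1 : l ∘ Tuple.sort l = l := by rw [hs]; rfl
  have h2 : Equiv.Perm.sign (Tuple.sort l) = 1 := by rw [hs]; exact Equiv.Perm.sign_refl
  rw [h2]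
  simp [h1]

theorem X_comp_perm (r : PosRoot n) (l : Fin r.i → Fin n) (σ : Equiv.Perm (Fin r.i)) :
    X r (l ∘ σ) = ((Equiv.Perm.sign σ : ℤ) : PolyRing n) * X r l := by
  by_cases h : Function.Injective l ∧ ∀ a, InRange r.i r.j (l a)
  · have h' : Function.Injective (l ∘ σ) ∧ ∀ a, InRange r.i r.j ((l ∘ σ) a) :=
      ⟨h.1.comp σ.injective, fun a => h.2 _⟩
    have e : (l ∘ σ) ∘ Tuple.sort (l ∘ σ) = l ∘ Tuple.sort l :=
      Tuple.comp_perm_comp_sort_eq_comp_sort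
    have hσ : σ * Tuple.sort (l ∘ σ) = Tuple.sort l := by
      ext a
      exact congrArg Fin.val (h.1 (congrFun e a))
    have hs : Tuple.sort (l ∘ σ) = σ⁻¹ * Tuple.sort l := by rw [← hσ]; group
    rw [X, dif_pos h', X, dif_pos h]
    rw [← mul_assoc]
    congr 1
    · rw [hs, Equiv.Perm.sign_mul, Equiv.Perm.sign_inv]
      push_cast
      ring
    · congr 1
      simp only [e]
  · have h' : ¬(Function.Injective (l ∘ σ) ∧ ∀ a, InRange r.i r.j ((l ∘ σ) a)) := by
      intro h'
      refine h ⟨?_, fun a => ?_⟩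
      · have := h'.1.comp σ.symm.injective
        rwa [Function.comp_assoc, Equiv.self_comp_symm, Function.comp_id] at this
      · simpa using h'.2 (σ.symm a)
    rw [X_eq_zero h, X_eq_zero h', mul_zero]

theorem exists_sorting (r : PosRoot n) (l : Fin r.i → Fin n) (h : Function.Injective l) :
    ∃ (σ : Equiv.Perm (Fin r.i)) (l' : Fin r.i → Fin n), StrictMono l' ∧ l = l' ∘ σ := by
  refine ⟨(Tuple.sort l)⁻¹, l ∘ Tuple.sort l,
    (Tuple.monotone_sort l).strictMono_of_injective (h.comp (Tuple.sort l).injective), ?_⟩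
  ext a
  simp

end Antisymmetry

/-! ### The open cell, its minors and its generic point. -/

section Cell

variable {n : ℕ} {R : Type*} [CommRing R]

/-- The column with index `x` of the matrix of the point of the open cell of `R_n` with
coordinates `c`, in the component with label `r`. -/
def cellVec (c : ℕ → ℕ → R) (r : PosRoot n) (x : Fin n) : Fin r.i → R := fun a =>
  if x.val < r.i then (if a.val = x.val then 1 else 0)
  else if r.j ≤ x.val then c a x else 0

/-- The minor with columns `l` of the matrix of a point of the open cell. -/
def minor (c : ℕ → ℕ → R) (r : PosRoot n) (l : Fin r.i → Fin n) : R :=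
  Matrix.detRowAlternating (fun b => cellVec c r (l b))

theorem cellVec_of_lt (c : ℕ → ℕ → R) (r : PosRoot n) (a : Fin r.i) :
    cellVec c r (Fin.castLE r.i_le a) = Pi.single a 1 := by
  ext b
  simp [cellVec, Pi.single_apply, Fin.ext_iff]

theorem cellVec_of_le (c : ℕ → ℕ → R) (r : PosRoot n) (x : Fin n) (h : r.j ≤ x.val) :
    cellVec c r x = fun a : Fin r.i => c a.val x.val := by
  ext b
  have := r.i_le_j
  rw [cellVec, if_neg (by omega), if_pos h]

theorem cellVec_of_not_inRange (c : ℕ → ℕ → R) (r : PosRoot n) (x : Fin n)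
    (h : ¬InRange r.i r.j x) : cellVec c r x = 0 := by
  ext b
  rw [InRange, not_or] at h
  rw [cellVec, if_neg h.1, if_neg h.2]; rfl

theorem minor_eq_zero (c : ℕ → ℕ → R) {r : PosRoot n} {l : Fin r.i → Fin n}
    (h : ¬(Function.Injective l ∧ ∀ a, InRange r.i r.j (l a))) : minor c r l = 0 := by
  by_cases hl : Function.Injective l
  · simp only [hl, true_and, not_forall] at h
    obtain ⟨a, ha⟩ := h
    exact AlternatingMap.map_coord_zero _ a (cellVec_of_not_inRange c r _ ha)
  · simp only [Function.Injective, not_forall] at hl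
    obtain ⟨a, b, hab, hne⟩ := hl
    exact AlternatingMap.map_eq_zero_of_eq _ _ (by rw [hab]) hne

theorem minor_comp_perm (c : ℕ → ℕ → R) (r : PosRoot n) (l : Fin r.i → Fin n)
    (σ : Equiv.Perm (Fin r.i)) :
    minor c r (l ∘ σ) = ((Equiv.Perm.sign σ : ℤ) : R) * minor c r l := by
  have := AlternatingMap.map_perm (Matrix.detRowAlternating (R := R))
    (fun b => cellVec c r (l b)) σ
  rw [Units.smul_def, zsmul_eq_mul] at this
  exact this

theorem minor_top (c : ℕ → ℕ → R) (r : PosRoot n) :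
    minor c r (Fin.castLE r.i_le) = 1 := by
  simp only [minor, cellVec_of_lt]
  have : (fun b : Fin r.i => (Pi.single b 1 : Fin r.i → R)) = (1 : Matrix _ _ R) := by
    ext a b
    simp [Matrix.one_apply, Pi.single_apply, eq_comm]
  rw [this]
  exact Matrix.det_one

theorem minor_map {S : Type*} [CommRing S] (f : R →+* S) (c : ℕ → ℕ → R) (r : PosRoot n)
    (l : Fin r.i → Fin n) : f (minor c r l) = minor (fun a b => f (c a b)) r l := by
  have h := RingHom.map_det f (Matrix.of fun b => cellVec c r (l b))
  refine h.trans ?_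
  rw [minor]
  change Matrix.det _ = Matrix.det _
  congr 1
  ext a b
  simp [cellVec, apply_ite f]

/-- Expansion of a minor along one of its columns. -/
theorem minor_expand (c : ℕ → ℕ → R) (r : PosRoot n) (l : Fin r.i → Fin n) (b : Fin r.i) :
    minor c r l =
      ∑ a, cellVec c r (l b) a * minor c r (Function.update l b (Fin.castLE r.i_le a)) := by
  have h1 : (fun d => cellVec c r (l d)) = Function.update (fun d => cellVec c r (l d)) b
      (∑ a, cellVec c r (l b) a • (Pi.single a 1 : Fin r.i → R)) := by
    rw [← pi_eq_sum_univ']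
    exact (Function.update_eq_self b _).symm
  rw [minor, h1, AlternatingMap.map_update_sum]
  refine Finset.sum_congr rfl fun a _ => ?_
  rw [AlternatingMap.map_update_smul, smul_eq_mul, minor]
  congr 2
  ext d : 1
  by_cases hd : d = b
  · subst hd; simp [cellVec_of_lt]
  · simp [hd]

variable [Algebra ℂ R]

/-- Evaluation of polynomials in Plücker variables at the point of the open cell with coordinates
`c`, with the homogeneous coordinates in the component with label `r` scaled by `t r`. -/
def cellHom (c : ℕ → ℕ → R) (t : PosRoot n → R) : PolyRing n →ₐ[ℂ] R :=
  MvPolynomial.aeval fun x : PluckerVar n => t x.1 * minor c x.1 x.2.1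

theorem cellHom_X (c : ℕ → ℕ → R) (t : PosRoot n → R) (r : PosRoot n) (l : Fin r.i → Fin n) :
    cellHom c t (X r l) = t r * minor c r l := by
  by_cases h : Function.Injective l ∧ ∀ a, InRange r.i r.j (l a)
  · obtain ⟨σ, l', hl', rfl⟩ := exists_sorting r l h.1
    have hr : ∀ a, InRange r.i r.j (l' a) := fun a => by simpa using h.2 (σ.symm a)
    rw [X_comp_perm, minor_comp_perm, X_of_strictMono r l' ⟨hl', hr⟩, map_mul, map_intCast,
      cellHom, MvPolynomial.aeval_X]
    ring
  · rw [X_eq_zero h, minor_eq_zero c h, map_zero, mul_zero]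

theorem cellHom_topX (c : ℕ → ℕ → R) (t : PosRoot n → R) (r : PosRoot n) :
    cellHom c t (topX r) = t r := by
  rw [topX, cellHom_X, minor_top, mul_one]

theorem map_cellHom {S : Type*} [CommRing S] [Algebra ℂ S] (f : R →ₐ[ℂ] S) (c : ℕ → ℕ → R)
    (t : PosRoot n → R) (F : PolyRing n) :
    f (cellHom c t F) = cellHom (fun a b => f (c a b)) (fun r => f (t r)) F := by
  have : f.comp (cellHom c t) = cellHom (fun a b => f (c a b)) (fun r => f (t r)) := by
    apply MvPolynomial.algHom_ext
    intro x
    have := minor_map f.toRingHom c x.1 x.2.1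
    simp only [AlgHom.toRingHom_eq_coe, RingHom.coe_coe] at this
    simp [cellHom, this]
  exact DFunLike.congr_fun this F

/-- The coordinate ring of the product of the open cell with the torus of scalings. -/
abbrev CellRing (n : ℕ) : Type := MvPolynomial ((ℕ × ℕ) ⊕ PosRoot n) ℂ

/-- Evaluation of polynomials in Plücker variables at the generic point of the open cell. -/
def genericHom (n : ℕ) : PolyRing n →ₐ[ℂ] CellRing n :=
  cellHom (fun a b => MvPolynomial.X (Sum.inl (a, b))) (fun r => MvPolynomial.X (Sum.inr r))

/-- Every evaluation on the cell, over any ℂ-algebra, is a specialization of the generic one. This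
is applied over a localization of the Plücker quotient and over the dual numbers. -/
theorem cellHom_eq_zero {F : PolyRing n} (hF : genericHom n F = 0) (c : ℕ → ℕ → R)
    (t : PosRoot n → R) : cellHom c t F = 0 := by
  have := map_cellHom (MvPolynomial.aeval (Sum.elim (fun p : ℕ × ℕ => c p.1 p.2) t))
    (fun a b => MvPolynomial.X (Sum.inl (a, b)) : ℕ → ℕ → CellRing n)
    (fun r => MvPolynomial.X (Sum.inr r)) F
  simp only [MvPolynomial.aeval_X, Sum.elim_inl, Sum.elim_inr] at this
  rw [← this, ← genericHom, hF, map_zero]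

/-- Complex points suffice, since a polynomial over an infinite field is determined by its values.
-/
theorem genericHom_eq_zero {F : PolyRing n}
    (hF : ∀ (c : ℕ → ℕ → ℂ) (t : PosRoot n → ℂ), cellHom c t F = 0) : genericHom n F = 0 := by
  apply MvPolynomial.funext
  intro p
  have := map_cellHom (MvPolynomial.aeval p)
    (fun a b => MvPolynomial.X (Sum.inl (a, b)) : ℕ → ℕ → CellRing n)
    (fun r => MvPolynomial.X (Sum.inr r)) F
  rw [hF] at this
  simpa [genericHom, MvPolynomial.aeval_eq_eval] using this

end Cell

/-! ### The kernel of the generic evaluation lies in the saturation. -/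

section Saturation

variable {n : ℕ}

/-- This is the relation with k = 1 and L = (1, …, i₁). Such an L satisfies the second admissibility
alternative automatically, and ε = 1 because S_{i₂,j₂} ⊂ {1, …, i₂, j₁+1, …, n} when j₁ ≤ j₂. -/
theorem exchange_first_mem {r s : PosRoot n} (hi : s.i ≤ r.i) (hj : r.j ≤ s.j)
    (P : Fin s.i → Fin n) (hP : Function.Injective P) (hPr : ∀ b, InRange s.i s.j (P b))
    (b : Fin s.i) (hb : b.val = 0) :
    topX r * X s P - ∑ a : Fin r.i, X r (Function.update (Fin.castLE r.i_le) a (P b)) *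
      X s (Function.update P b (Fin.castLE r.i_le a)) ∈ pluckerIdeal n := by
  have hrij := r.i_le_j
  have hk : 1 ≤ s.i := s.i_pos
  have hb0 : Fin.castLE hk 0 = b := by ext; simp [hb]
  refine Ideal.subset_span ⟨r, s, 1, hk, Fin.castLE r.i_le, P,
    ⟨hi, le_rfl, Fin.castLE_injective _, fun a => Or.inl ?_, hP, hPr, Or.inr ⟨hj, fun a =>
      Or.inl ?_⟩⟩, ?_⟩
  · simp
  · simp
  rw [pluckerRelation, if_pos]
  swap
  · intro t
    rcases hPr (Fin.castLE hk t) with h | h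
    · exact Or.inl h
    · exact Or.inr (hj.trans h)
  rw [topX]
  congr 1
  rw [← (Equiv.funUnique (Fin 1) (Fin r.i)).symm.sum_comp]
  refine Finset.sum_congr rfl fun a _ => ?_
  have hρ : ((Equiv.funUnique (Fin 1) (Fin r.i)).symm a) = fun _ => a := rfl
  rw [hρ]
  have hmono : StrictMono (fun _ : Fin 1 => a) := Subsingleton.strictMono _
  have hext : Function.extend (fun _ : Fin 1 => a) (fun t => P (Fin.castLE hk t))
      (Fin.castLE r.i_le) = Function.update (Fin.castLE r.i_le) a (P b) := by
    ext d : 1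
    by_cases hd : d = a
    · subst hd
      rw [Function.update_self]
      have := Function.Injective.extend_apply (f := fun _ : Fin 1 => d)
        (Function.injective_of_subsingleton _) (fun t => P (Fin.castLE hk t))
        (Fin.castLE r.i_le) 0
      rw [this, hb0]
    · rw [Function.update_of_ne hd, Function.extend_apply']
      rintro ⟨_, h⟩
      exact hd h.symm
  have hupd : (fun d : Fin s.i => if h : d.val < 1 then Fin.castLE r.i_le a else P d) =
      Function.update P b (Fin.castLE r.i_le a) := by
    ext d : 1
    by_cases hd : d = b
    · subst hd; simp [hb]
    · have : ¬ d.val < 1 := by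
        intro h
        exact hd (Fin.ext (by omega))
      rw [Function.update_of_ne hd, dif_neg this]
  rw [hext, hupd]
  -- The positions omitted from the sum in the relation contribute zero anyway: there the second
  -- factor has an index outside its range.
  split_ifs with hcond
  · rfl
  · have hz : X s (Function.update P b (Fin.castLE r.i_le a)) = 0 := by
      apply X_eq_zero
      rintro ⟨-, h⟩
      refine hcond ⟨hmono, fun _ => ?_⟩
      have h := h b
      rw [Function.update_self] at h
      rcases h with h | h
      · exact Or.inl h
      · exact Or.inr (hj.trans h)
    rw [hz, mul_zero]

/-- The exchange relation between the component with label `s` and the largest coordinate of the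
component with label `r`, for an arbitrary position in `P`. -/
theorem exchange_mem {r s : PosRoot n} (hi : s.i ≤ r.i) (hj : r.j ≤ s.j)
    (P : Fin s.i → Fin n) (hP : Function.Injective P) (hPr : ∀ b, InRange s.i s.j (P b))
    (b : Fin s.i) :
    topX r * X s P - ∑ a : Fin r.i, X r (Function.update (Fin.castLE r.i_le) a (P b)) *
      X s (Function.update P b (Fin.castLE r.i_le a)) ∈ pluckerIdeal n := by
  set b₀ : Fin s.i := ⟨0, s.i_pos⟩ with hb₀
  -- Moving position `b` to the front multiplies every term by the same sign.
  set σ : Equiv.Perm (Fin s.i) := Equiv.swap b₀ b with hσ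
  have key := exchange_first_mem hi hj (P ∘ σ) (hP.comp σ.injective) (fun _ => hPr _) b₀ rfl
  have hupd : ∀ y, Function.update (P ∘ σ) b₀ y = Function.update P b y ∘ σ := by
    intro y
    have : b₀ = σ.symm b := by simp [hσ]
    rw [this, Function.update_comp_equiv]
  have hPb : (P ∘ σ) b₀ = P b := by simp [hσ]
  have hsq : ((Equiv.Perm.sign σ : ℤ) : PolyRing n) * ((Equiv.Perm.sign σ : ℤ) : PolyRing n) = 1 := by
    rw [← Int.cast_mul, ← Units.val_mul, Int.units_mul_self]; simp
  have hsum : ∀ a : Fin r.i, X r (Function.update (Fin.castLE r.i_le) a ((P ∘ σ) b₀)) *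
      X s (Function.update (P ∘ σ) b₀ (Fin.castLE r.i_le a)) =
      ((Equiv.Perm.sign σ : ℤ) : PolyRing n) *
        (X r (Function.update (Fin.castLE r.i_le) a (P b)) *
          X s (Function.update P b (Fin.castLE r.i_le a))) := by
    intro a
    rw [hupd, hPb, X_comp_perm, mul_left_comm]
  rw [Finset.sum_congr rfl fun a _ => hsum a, ← Finset.mul_sum, X_comp_perm, mul_left_comm,
    ← mul_sub] at key
  have := (pluckerIdeal n).mul_mem_left ((Equiv.Perm.sign σ : ℤ) : PolyRing n) key
  rwa [← mul_assoc, hsq, one_mul] at this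

/-- The root `α_{a+1,x}`. -/
def rootOf (a x : ℕ) (h : a < x) (hx : x < n) : PosRoot n :=
  ⟨(⟨a + 1, by omega⟩, ⟨x, hx⟩), by simp, by simpa using h⟩

variable {A : Type*} [CommRing A] [Algebra ℂ A]

/-- The ratios of Plücker coordinates of two components agree. -/
theorem ratio_eq (ψ : PolyRing n →ₐ[ℂ] A) (hψ : ∀ F ∈ pluckerIdeal n, ψ F = 0)
    {r s : PosRoot n} (hi : s.i ≤ r.i) (hj : r.j ≤ s.j) (a : Fin s.i) (x : Fin n)
    (hx : s.j ≤ x.val) :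
    ψ (topX r) * ψ (X s (Function.update (Fin.castLE s.i_le) a x)) =
      ψ (X r (Function.update (Fin.castLE r.i_le) (Fin.castLE hi a) x)) * ψ (topX s) := by
  have hrij := r.i_le_j
  have hsij := s.i_le_j
  have hne : ∀ d : Fin s.i, Fin.castLE s.i_le d ≠ x := by
    intro d h
    have := congrArg Fin.val h
    have := d.isLt
    simp at *
    omega
  have hinj : Function.Injective (Function.update (Fin.castLE s.i_le) a x) := by
    intro d e h
    by_cases hd : d = a <;> by_cases he : e = a
    · rw [hd, he]
    · subst hd
      rw [Function.update_self, Function.update_of_ne he] at h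
      exact absurd h.symm (hne _)
    · subst he
      rw [Function.update_self, Function.update_of_ne hd] at h
      exact absurd h (hne _)
    · rw [Function.update_of_ne hd, Function.update_of_ne he] at h
      exact Fin.castLE_injective _ h
  have hran : ∀ b, InRange s.i s.j (Function.update (Fin.castLE s.i_le) a x b) := by
    intro b
    by_cases hb : b = a
    · subst hb; rw [Function.update_self]; exact Or.inr hx
    · rw [Function.update_of_ne hb]; exact Or.inl (by simp)
  have key := hψ _ (exchange_mem hi hj _ hinj hran a)
  rw [Finset.sum_eq_single (Fin.castLE hi a)] at key
  · have hself : Function.update (Fin.castLE s.i_le) a (Fin.castLE r.i_le (Fin.castLE hi a)) =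
        Fin.castLE s.i_le := Function.update_eq_self a _
    rw [Function.update_self, Function.update_idem, hself, map_sub, map_mul, map_mul,
      sub_eq_zero] at key
    exact key
  -- For `d ≠ a` the second factor vanishes: its index `d` is a repetition if `d < s.i`, and
  -- otherwise lies in the gap `s.i ≤ d < r.i ≤ r.j ≤ s.j`.
  · intro d _ hd
    rw [Function.update_idem, X_eq_zero (r := s), mul_zero]
    rintro ⟨h1, h2⟩
    have h2 := h2 a
    rw [Function.update_self, InRange] at h2
    have hd2 : d.val < s.i := by
      rcases h2 with h | h
      · simpa using h
      · have := d.isLt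
        simp at h; omega
    have hda : (⟨d.val, hd2⟩ : Fin s.i) ≠ a := by
      rintro rfl
      exact hd rfl
    refine hda (h1 ?_)
    rw [Function.update_self, Function.update_of_ne hda]
    rfl
  · simp

/-- A homomorphism killing the Plücker relations and inverting the largest coordinates is the
evaluation at a point of the open cell. -/
theorem exists_cellHom (ψ : PolyRing n →ₐ[ℂ] A) (hψ : ∀ F ∈ pluckerIdeal n, ψ F = 0)
    (hu : ∀ r, IsUnit (ψ (topX r))) :
    ∃ (c : ℕ → ℕ → A) (t : PosRoot n → A), ψ = cellHom c t := by
  classical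
  -- The coordinate c_{a,x} is read off in the component with `i = a + 1`, `j = x`, the extreme one
  -- containing this entry; `ratio_eq` carries it to all others. The default 0 is harmless, since an
  -- entry of row `a` beyond column `j` always has `a < i ≤ j ≤ x`.
  let c : ℕ → ℕ → A := fun a x => if h : a < x ∧ x < n then
    ((hu (rootOf a x h.1 h.2)).unit⁻¹ : Aˣ) *
      ψ (X (rootOf a x h.1 h.2) (Function.update (Fin.castLE (PosRoot.i_le _))
        ⟨a, Nat.lt_succ_self a⟩ ⟨x, h.2⟩)) else 0
  let t : PosRoot n → A := fun r => ψ (topX r)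
  have hcoord : ∀ (r : PosRoot n) (a : Fin r.i) (x : Fin n),
      ψ (X r (Function.update (Fin.castLE r.i_le) a x)) = t r * cellVec c r x a := by
    intro r a x
    have hrij := r.i_le_j
    have ha := a.isLt
    by_cases hx : x.val < r.i
    · by_cases hax : a.val = x.val
      · have : x = Fin.castLE r.i_le a := Fin.ext hax.symm
        subst this
        rw [Function.update_eq_self]
        simp [cellVec, t, topX]
      · rw [cellVec, if_pos hx, if_neg hax, mul_zero, X_eq_zero, map_zero]
        rintro ⟨h, -⟩
        have hne : (⟨x.val, hx⟩ : Fin r.i) ≠ a := fun e => hax (by rw [← e])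
        refine hne (h ?_)
        rw [Function.update_self, Function.update_of_ne hne]
        rfl
    · by_cases hjx : r.j ≤ x.val
      · have h : a.val < x.val ∧ x.val < n := ⟨by omega, x.isLt⟩
        have key := ratio_eq ψ hψ (r := r) (s := rootOf a x h.1 h.2) ha hjx
          ⟨a, Nat.lt_succ_self a⟩ x le_rfl
        rw [cellVec_of_le _ _ _ hjx]
        simp only [c, dif_pos h, t]
        have hinv := (hu (rootOf a x h.1 h.2)).val_inv_mul
        change _ = ψ (X r (Function.update (Fin.castLE r.i_le) a x)) * _ at key
        linear_combination (-ψ (X r (Function.update (Fin.castLE r.i_le) a x))) * hinv -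
          (((hu (rootOf a x h.1 h.2)).unit⁻¹ : Aˣ) : A) * key
      · rw [cellVec, if_neg hx, if_neg hjx, mul_zero, X_eq_zero, map_zero]
        rintro ⟨-, h⟩
        have h := h a
        rw [Function.update_self] at h
        exact h.elim hx hjx
  -- Induction on the number of indices of `P` outside {1, …, i}. Exchanging such an index against
  -- (1, …, i) lowers this number, and the exchange relation is the expansion of the minor along
  -- that column.
  have hall : ∀ (r : PosRoot n) (N : ℕ) (P : Fin r.i → Fin n),
      (Finset.univ.filter fun b => r.i ≤ (P b).val).card = N → ψ (X r P) = t r * minor c r P := by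
    intro r N
    induction N using Nat.strong_induction_on with
    | _ N ih =>
      intro P hN
      by_cases hP : Function.Injective P ∧ ∀ b, InRange r.i r.j (P b)
      swap
      · rw [X_eq_zero hP, minor_eq_zero c hP, map_zero, mul_zero]
      by_cases hex : ∃ b, r.i ≤ (P b).val
      · obtain ⟨b, hb⟩ := hex
        have key := hψ _ (exchange_mem (r := r) (s := r) le_rfl le_rfl P hP.1 hP.2 b)
        rw [map_sub, map_mul, map_sum, sub_eq_zero] at key
        have hterm : ∀ a : Fin r.i, ψ (X r (Function.update P b (Fin.castLE r.i_le a))) =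
            t r * minor c r (Function.update P b (Fin.castLE r.i_le a)) := by
          intro a
          refine ih _ ?_ _ rfl
          rw [← hN]
          apply Finset.card_lt_card
          refine ⟨fun d hd => ?_, fun hsub => ?_⟩
          · simp only [Finset.mem_filter, Finset.mem_univ, true_and] at hd ⊢
            by_cases hdb : d = b
            · rw [hdb]; exact hb
            · rwa [Function.update_of_ne hdb] at hd
          · have := hsub (Finset.mem_filter.2 ⟨Finset.mem_univ b, hb⟩)
            simp only [Finset.mem_filter, Function.update_self, Fin.val_castLE] at this
            have := a.isLt
            omega
        apply (hu r).mul_left_cancel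
        rw [key, minor_expand c r P b, Finset.mul_sum, Finset.mul_sum]
        refine Finset.sum_congr rfl fun a _ => ?_
        rw [map_mul, hcoord, hterm]
        ring
      -- No index lies beyond `i`, so `P` is a permutation of (1, …, i).
      · push Not at hex
        let f : Fin r.i → Fin r.i := fun b => ⟨(P b).val, hex b⟩
        have hf : Function.Bijective f := by
          apply Finite.injective_iff_bijective.1
          intro b d h
          exact hP.1 (Fin.ext (congrArg Fin.val h :))
        have hPf : P = Fin.castLE r.i_le ∘ Equiv.ofBijective f hf := by
          ext b; rfl
        rw [hPf, X_comp_perm, minor_comp_perm, minor_top, map_mul, map_intCast]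
        simp only [t, topX]
        ring
  refine ⟨c, t, ?_⟩
  apply MvPolynomial.algHom_ext
  rintro ⟨r, L, hL⟩
  rw [← X_of_strictMono r L hL, hall r _ L rfl, cellHom_X]

/-- A polynomial vanishing on the open cell is multiplied into the ideal of Plücker relations by a
product of powers of the largest coordinates. -/
theorem exists_mul_mem_pluckerIdeal {F : PolyRing n} (hF : genericHom n F = 0) :
    ∃ N : PosRoot n → ℕ, (∏ r, topX r ^ N r) * F ∈ pluckerIdeal n := by
  let Q := PolyRing n ⧸ pluckerIdeal n
  let x : Q := Ideal.Quotient.mk (pluckerIdeal n) (∏ r, topX r)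
  -- An element of the quotient that dies here is annihilated by a power of the product of the
  -- largest coordinates.
  let A := Localization.Away x
  let ψ : PolyRing n →ₐ[ℂ] A :=
    (IsScalarTower.toAlgHom ℂ Q A).comp (Ideal.Quotient.mkₐ ℂ (pluckerIdeal n))
  have hψ : ∀ G, ψ G = algebraMap Q A (Ideal.Quotient.mk (pluckerIdeal n) G) := fun G => rfl
  obtain ⟨c, t, h⟩ := exists_cellHom ψ
    (fun G hG => by rw [hψ, Ideal.Quotient.eq_zero_iff_mem.2 hG, map_zero])
    (fun r => by
      have hx : IsUnit (algebraMap Q A x) := IsLocalization.Away.algebraMap_isUnit x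
      refine isUnit_of_dvd_unit ?_ hx
      rw [hψ]
      exact map_dvd _ (map_dvd _ (Finset.dvd_prod_of_mem _ (Finset.mem_univ r))))
  have hzero : algebraMap Q A (Ideal.Quotient.mk (pluckerIdeal n) F) = 0 := by
    rw [← hψ, h]
    exact cellHom_eq_zero hF c t
  rw [IsLocalization.map_eq_zero_iff (Submonoid.powers x)] at hzero
  obtain ⟨⟨_, N, rfl⟩, hN⟩ := hzero
  refine ⟨fun _ => N, ?_⟩
  rw [Finset.prod_pow, ← Ideal.Quotient.eq_zero_iff_mem, map_mul, map_pow]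
  exact hN

end Saturation

/-! ### The exchange identity for determinants. -/

section Exchange

variable {R : Type*} [CommRing R]

theorem extend_update {ι κ N : Type*} [DecidableEq ι] [DecidableEq κ] {ρ : κ → ι}
    (hρ : Function.Injective ρ) (y : κ → N) (z : ι → N) (t : κ) (p : N) :
    Function.extend ρ (Function.update y t p) z =
      Function.update (Function.extend ρ y z) (ρ t) p := by
  ext i : 1
  by_cases hi : ∃ a, ρ a = i
  · obtain ⟨a, rfl⟩ := hi
    rw [hρ.extend_apply]
    by_cases hat : a = t
    · subst hat; simp
    · rw [Function.update_of_ne hat, Function.update_of_ne (hρ.ne hat), hρ.extend_apply]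
  · rw [Function.extend_apply' _ _ _ hi, Function.update_of_ne, Function.extend_apply' _ _ _ hi]
    rintro rfl
    exact hi ⟨t, rfl⟩

/-- The alternating map in the arguments at the positions `ρ` obtained by fixing the remaining
arguments of an alternating map. -/
def fixArgs {ι κ N : Type*} [AddCommGroup N] [Module R N] (g : N [⋀^ι]→ₗ[R] R) (ρ : κ → ι)
    (hρ : Function.Injective ρ) (z : ι → N) : N [⋀^κ]→ₗ[R] R where
  toFun y := g (Function.extend ρ y z)
  map_update_add' y t p q := by
    classical
    rw [extend_update hρ, extend_update hρ, extend_update hρ, g.map_update_add]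
  map_update_smul' y t a p := by
    classical
    rw [extend_update hρ, extend_update hρ, g.map_update_smul]
  map_eq_zero_of_eq' y a b h hab := by
    refine g.map_eq_zero_of_eq _ (i := ρ a) (j := ρ b) ?_ (hρ.ne hab)
    rw [hρ.extend_apply, hρ.extend_apply, h]

theorem fixArgs_apply {ι κ N : Type*} [AddCommGroup N] [Module R N] (g : N [⋀^ι]→ₗ[R] R)
    (ρ : κ → ι) (hρ : Function.Injective ρ) (z : ι → N) (y : κ → N) :
    fixArgs g ρ hρ z y = g (Function.extend ρ y z) := rfl

/-- Expansion of an alternating form in the coordinates of its arguments. -/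
theorem alternating_expand {m k : ℕ} (D : (Fin m → R) [⋀^Fin k]→ₗ[R] R)
    (x : Fin k → Fin m → R) :
    D x = ∑ ρ : Fin k ↪o Fin m,
      Matrix.detRowAlternating (Function.extend ρ x fun a => Pi.single a 1) *
        D fun t => Pi.single (ρ t) 1 := by
  classical
  let e : Fin m → Fin m → R := fun a => Pi.single a 1
  have hdet : Matrix.detRowAlternating (R := R) e = 1 := by
    have : e = (1 : Matrix _ _ R) := by
      ext a b
      simp [e, Matrix.one_apply, Pi.single_apply, eq_comm]
    rw [this]
    exact Matrix.det_one
  let E : (Fin m → R) [⋀^Fin k]→ₗ[R] R := ∑ ρ : Fin k ↪o Fin m,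
    (D fun t => e (ρ t)) • fixArgs Matrix.detRowAlternating ρ ρ.injective e
  have hE : ∀ y, E y = ∑ ρ : Fin k ↪o Fin m,
      Matrix.detRowAlternating (Function.extend ρ y e) * D fun t => e (ρ t) := by
    intro y
    let ev : ((Fin m → R) [⋀^Fin k]→ₗ[R] R) →+ R :=
      { toFun := fun f => f y, map_zero' := rfl, map_add' := fun _ _ => rfl }
    refine (map_sum ev _ _).trans ?_
    exact Finset.sum_congr rfl fun _ _ => mul_comm _ _
  suffices h : D = E by
    conv_lhs => rw [h]
    exact hE x
  refine Module.Basis.ext_alternating (Pi.basisFun R (Fin m)) fun τ hτ => ?_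
  simp only [Pi.basisFun_apply]
  change D (fun t => e (τ t)) = E (fun t => e (τ t))
  let σ := Tuple.sort τ
  let ρ₀ : Fin k ↪o Fin m := OrderEmbedding.ofStrictMono (τ ∘ σ)
    ((Tuple.monotone_sort τ).strictMono_of_injective (hτ.comp σ.injective))
  have hτρ : (fun t => e (τ t)) = (fun t => e (ρ₀ t)) ∘ ⇑σ⁻¹ := by
    ext t : 1
    change e (τ t) = e (τ (σ (σ⁻¹ t)))
    simp
  have hEρ : E (fun t => e (ρ₀ t)) = D (fun t => e (ρ₀ t)) := by
    rw [hE, Finset.sum_eq_single ρ₀]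
    · have : Function.extend ρ₀ (fun t => e (ρ₀ t)) e = e := by
        ext a : 1
        by_cases ha : ∃ t, ρ₀ t = a
        · obtain ⟨t, rfl⟩ := ha
          rw [ρ₀.injective.extend_apply]
        · rw [Function.extend_apply' _ _ _ ha]
      rw [this, hdet, one_mul]
    · intro ρ _ hρ
      -- Two distinct increasing sequences of equal length have different ranges. The unit vector at
      -- a missed `ρ₀ t` then occurs in two rows, at `ρ t` and at `ρ₀ t`.
      have hex : ∃ t, ρ₀ t ∉ Set.range ρ := by
        by_contra hcon
        push Not at hcon
        refine hρ ?_
        have hsub : Set.range ρ₀ ⊆ Set.range ρ := by rintro _ ⟨t, rfl⟩; exact hcon t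
        have heq : Set.range ρ₀ = Set.range ρ := by
          apply Set.eq_of_subset_of_ncard_le hsub
          rw [← Set.image_univ, ← Set.image_univ, Set.ncard_image_of_injective _ ρ.injective,
            Set.ncard_image_of_injective _ ρ₀.injective]
        exact OrderEmbedding.range_inj.1 heq.symm
      obtain ⟨t, ht⟩ := hex
      rw [AlternatingMap.map_eq_zero_of_eq (i := ρ₀ t) (j := ρ t), zero_mul]
      · rw [ρ.injective.extend_apply, Function.extend_apply' _ _ _ ht]
      · intro h
        exact ht ⟨t, h.symm⟩
    · simp
  rw [hτρ, AlternatingMap.map_perm, AlternatingMap.map_perm, hEρ]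

theorem vecMul_extend {m : Type*} [Fintype m] {κ ι : Type*} (ρ : κ → ι) (x : κ → m → R)
    (z : ι → m → R) (u : Matrix m m R) (i : ι) :
    Function.extend ρ (fun t => Matrix.vecMul (x t) u) (fun a => Matrix.vecMul (z a) u) i =
      Matrix.vecMul (Function.extend ρ x z i) u := by
  classical
  rw [Function.extend_def, Function.extend_def]
  split_ifs <;> rfl

/-- The rows of `u` form a basis, so `alternating_expand` applies to `D` transported by `u`;
multiplicativity of the determinant restores the original rows. -/
theorem det_mul_alternating_of_isUnit {m k : ℕ} (D : (Fin m → R) [⋀^Fin k]→ₗ[R] R)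
    (x : Fin k → Fin m → R) (u : Matrix (Fin m) (Fin m) R) (hu : IsUnit u.det) :
    u.det * D x = ∑ ρ : Fin k ↪o Fin m,
      Matrix.detRowAlternating (Function.extend ρ x u) * D fun t => u (ρ t) := by
  let x' : Fin k → Fin m → R := fun t => Matrix.vecMul (x t) u⁻¹
  have hx' : ∀ t, Matrix.vecMul (x' t) u = x t := by
    intro t
    simp only [x', Matrix.vecMul_vecMul, Matrix.nonsing_inv_mul u hu, Matrix.vecMul_one]
  have hu' : ∀ a, Matrix.vecMul (Pi.single a 1) u = u a := by
    intro a
    exact Matrix.single_one_vecMul a u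
  have key := alternating_expand (D.compLinearMap (Matrix.vecMulLinear u)) x'
  simp only [AlternatingMap.compLinearMap_apply, Matrix.vecMulLinear_apply, hx', hu'] at key
  rw [key, Finset.mul_sum]
  refine Finset.sum_congr rfl fun ρ _ => ?_
  rw [← mul_assoc]
  congr 1
  rw [mul_comm]
  refine (Matrix.det_mul (Function.extend ρ x' fun a => Pi.single a 1) u).symm.trans ?_
  refine congrArg Matrix.det ?_
  funext a
  have := vecMul_extend ρ x' (fun a => Pi.single a 1) u a
  simp only [hx', hu'] at this
  exact this.symm

/-- The exchange identity for a determinant and an alternating form. -/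
theorem det_mul_alternating {m k : ℕ} (D : (Fin m → ℂ) [⋀^Fin k]→ₗ[ℂ] ℂ)
    (x : Fin k → Fin m → ℂ) (u : Matrix (Fin m) (Fin m) ℂ) :
    u.det * D x = ∑ ρ : Fin k ↪o Fin m,
      Matrix.detRowAlternating (Function.extend ρ x u) * D fun t => u (ρ t) := by
  -- The matrix s + u is singular only when s is an eigenvalue of -u. Invertible members are
  -- therefore dense in this pencil, and continuity gives the identity at s = 0.
  let v : ℂ → Matrix (Fin m) (Fin m) ℂ := fun s => s • (1 : Matrix (Fin m) (Fin m) ℂ) + u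
  have hv : Continuous v := by fun_prop
  have hvrow : ∀ a, Continuous fun s => v s a := fun a => (continuous_apply a).comp hv
  let S : Set ℂ := {s | IsUnit (v s).det}
  have hS : Dense S := by
    have : Sᶜ ⊆ {s | s ∈ (-u).charpoly.roots} := by
      intro s hs
      simp only [Set.mem_compl_iff, S, Set.mem_ofPred_eq, isUnit_iff_ne_zero, not_not] at hs
      simp only [Set.mem_ofPred_eq]
      rw [Polynomial.mem_roots (Matrix.charpoly_monic _).ne_zero, Polynomial.IsRoot,
        Matrix.eval_charpoly, ← hs]
      congr 1
      simp [v, Matrix.scalar_apply, ← Matrix.smul_one_eq_diagonal]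
    have hfin : Sᶜ.Finite := by
      refine Set.Finite.subset ?_ this
      exact (Multiset.finite_toSet _)
    simpa using hfin.countable.dense_compl ℂ
  have hD : Continuous D := by
    rw [funext (alternating_expand D)]
    refine continuous_finsetSum _ fun ρ _ => Continuous.mul ?_ continuous_const
    refine Continuous.matrix_det (continuous_pi fun a => ?_)
    by_cases ha : ∃ t, ρ t = a
    · obtain ⟨t, rfl⟩ := ha
      refine (continuous_apply t).congr fun y => ?_
      exact (ρ.injective.extend_apply _ _ _).symm
    · refine (continuous_const (y := (Pi.single a 1 : Fin m → ℂ))).congr fun y => ?_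
      exact (Function.extend_apply' y (fun a => (Pi.single a 1 : Fin m → ℂ)) a ha).symm
  have h1 : Continuous fun s => (v s).det * D x := (hv.matrix_det).mul continuous_const
  have h2 : Continuous fun s => ∑ ρ : Fin k ↪o Fin m,
      Matrix.detRowAlternating (Function.extend ρ x (v s)) * D fun t => v s (ρ t) := by
    refine continuous_finsetSum _ fun ρ _ => Continuous.mul ?_ ?_
    · refine Continuous.matrix_det (continuous_pi fun a => ?_)
      by_cases ha : ∃ t, ρ t = a
      · obtain ⟨t, rfl⟩ := ha
        refine (continuous_const (y := x t)).congr fun s => ?_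
        exact (ρ.injective.extend_apply _ _ _).symm
      · refine (hvrow a).congr fun s => ?_
        exact (Function.extend_apply' _ _ _ ha).symm
    · exact hD.comp (continuous_pi fun t => hvrow _)
  have := congrFun (h1.ext_on hS h2 fun s hs => det_mul_alternating_of_isUnit D x (v s) hs) 0
  simpa [v] using this

theorem sum_orderEmbedding {m k : ℕ} {M : Type*} [AddCommMonoid M] (f : (Fin k → Fin m) → M)
    [DecidablePred fun ρ : Fin k → Fin m => StrictMono ρ] :
    ∑ ρ : Fin k ↪o Fin m, f ρ = ∑ ρ : Fin k → Fin m, if StrictMono ρ then f ρ else 0 := by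
  rw [← Finset.sum_filter]
  refine Finset.sum_bij (fun ρ _ => ⇑ρ) (fun ρ _ => by simpa using ρ.strictMono)
    (fun ρ _ ρ' _ h => DFunLike.coe_injective h)
    (fun ρ hρ => ⟨OrderEmbedding.ofStrictMono ρ (by simpa using hρ), Finset.mem_univ _, rfl⟩)
    (fun _ _ => rfl)

end Exchange

/-! ### The generalized Plücker relations vanish on the cell. -/

section Relations

variable {n : ℕ}

/-- This explains the set {1, …, i₂, j₁+1, …, n} in the relations. Cutting a column of component 1
down to its first i₂ entries kills the unit vectors with index above i₂, while the columns up to i₂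
or beyond j₁ become the columns of component 2. -/
theorem funLeft_cellVec {r₁ r₂ : PosRoot n} (c : ℕ → ℕ → ℂ) (hi : r₂.i ≤ r₁.i) (x : Fin n)
    [Decidable (InRange r₂.i r₁.j x)] (hx : r₁.j ≤ x.val → r₂.j ≤ x.val) :
    LinearMap.funLeft ℂ ℂ (Fin.castLE hi) (cellVec c r₁ x) =
      if InRange r₂.i r₁.j x then cellVec c r₂ x else 0 := by
  have h1 := r₁.i_le_j
  ext a
  have ha := a.isLt
  simp only [LinearMap.funLeft_apply]
  by_cases hx1 : r₁.j ≤ x.val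
  · rw [if_pos (show InRange r₂.i r₁.j x from Or.inr hx1), cellVec_of_le _ _ _ hx1, cellVec_of_le _ _ _ (hx hx1)]
    simp
  · by_cases hx2 : x.val < r₂.i
    · rw [if_pos (show InRange r₂.i r₁.j x from Or.inl hx2), cellVec, cellVec, if_pos hx2, if_pos (by omega)]
      simp
    · rw [if_neg (by rintro (h | h) <;> omega), cellVec, if_neg hx1]
      split_ifs with h3 h4
      · simp at h4; omega
      · rfl
      · rfl

/-- The relation is `det_mul_alternating` for the columns `L` of component 1. The form `D` truncates
k vectors to length i₂ and puts them in place of the first k columns of the minor of `P`. Its value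
on the columns p_1, …, p_k of component 1 is ε times that minor. -/
theorem cellHom_pluckerRelation {r₁ r₂ : PosRoot n} {k : ℕ} (hk : k ≤ r₂.i)
    {L : Fin r₁.i → Fin n} {P : Fin r₂.i → Fin n} (h : IsAdmissible r₁ r₂ k L P)
    (c : ℕ → ℕ → ℂ) (t : PosRoot n → ℂ) :
    cellHom c t (pluckerRelation r₁ r₂ k hk L P) = 0 := by
  classical
  obtain ⟨hi, -, -, hL, -, hP, hcase⟩ := h
  have h1 := r₁.i_le_j
  have h2 := r₂.i_le_j
  -- The admissibility alternatives are used only here and for `P`: columns beyond j₁ must also lie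
  -- beyond j₂ for truncation to match the two components.
  have hLj : ∀ a, r₁.j ≤ (L a).val → r₂.j ≤ (L a).val := by
    intro a ha
    rcases hcase with h | h
    · omega
    · rcases h.2 a with h' | h'
      · omega
      · exact h'
  have hPj : ∀ b, r₁.j ≤ (P b).val → r₂.j ≤ (P b).val := by
    intro a ha
    rcases hcase with h | h
    · omega
    · rcases hP a with h' | h'
      · omega
      · exact h'
  let D : (Fin r₁.i → ℂ) [⋀^Fin k]→ₗ[ℂ] ℂ :=
    (fixArgs Matrix.detRowAlternating (Fin.castLE hk) (Fin.castLE_injective hk)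
      fun b => cellVec c r₂ (P b)).compLinearMap (LinearMap.funLeft ℂ ℂ (Fin.castLE hi))
  have hD : ∀ l : Fin k → Fin n, (∀ s, r₁.j ≤ (l s).val → r₂.j ≤ (l s).val) →
      D (fun s => cellVec c r₁ (l s)) =
        if ∀ s, InRange r₂.i r₁.j (l s) then
          minor c r₂ (fun b => if h : b.val < k then l ⟨b.val, h⟩ else P b) else 0 := by
    intro l hl
    have e : D (fun s => cellVec c r₁ (l s)) = Matrix.detRowAlternating
        (Function.extend (Fin.castLE hk)
          (fun s => if InRange r₂.i r₁.j (l s) then cellVec c r₂ (l s) else 0)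
          fun b => cellVec c r₂ (P b)) := by
      simp only [D, AlternatingMap.compLinearMap_apply, fixArgs_apply]
      congr 2
      funext s
      exact funLeft_cellVec c hi (l s) (hl s)
    rw [e]
    split_ifs with hin
    · rw [minor]
      congr 1
      funext b
      by_cases hb : b.val < k
      · have : b = Fin.castLE hk ⟨b.val, hb⟩ := rfl
        rw [dif_pos hb]
        conv_lhs => rw [this]
        rw [(Fin.castLE_injective hk).extend_apply, if_pos (hin _)]
      · rw [dif_neg hb, Function.extend_apply']
        rintro ⟨s, rfl⟩
        exact hb (by simp)
    · push Not at hin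
      obtain ⟨s, hs⟩ := hin
      refine AlternatingMap.map_coord_zero _ (Fin.castLE hk s) ?_
      rw [(Fin.castLE_injective hk).extend_apply, if_neg hs]
  have key := det_mul_alternating D (fun s => cellVec c r₁ (P (Fin.castLE hk s)))
    (fun a => cellVec c r₁ (L a))
  have hext : ∀ ρ : Fin k ↪o Fin r₁.i,
      Function.extend ρ (fun s => cellVec c r₁ (P (Fin.castLE hk s)))
        (fun a => cellVec c r₁ (L a)) =
      fun a => cellVec c r₁ (Function.extend ρ (fun s => P (Fin.castLE hk s)) L a) := by
    intro ρ
    funext a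
    by_cases ha : ∃ s, ρ s = a
    · obtain ⟨s, rfl⟩ := ha
      rw [ρ.injective.extend_apply, ρ.injective.extend_apply]
    · rw [Function.extend_apply' _ _ _ ha, Function.extend_apply' _ _ _ ha]
  rw [hD _ fun s => hPj _] at key
  have hself : (fun b : Fin r₂.i => if h : b.val < k then P (Fin.castLE hk ⟨b.val, h⟩) else P b) =
      P := by
    funext b
    split_ifs <;> rfl
  rw [hself] at key
  have hsum : ∀ ρ : Fin k ↪o Fin r₁.i,
      Matrix.detRowAlternating (Function.extend ρ (fun s => cellVec c r₁ (P (Fin.castLE hk s)))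
        (fun a => cellVec c r₁ (L a))) * D (fun s => cellVec c r₁ (L (ρ s))) =
      minor c r₁ (Function.extend ρ (fun s => P (Fin.castLE hk s)) L) *
        if ∀ s, InRange r₂.i r₁.j (L (ρ s)) then
          minor c r₂ (fun b => if h : b.val < k then L (ρ ⟨b.val, h⟩) else P b) else 0 := by
    intro ρ
    rw [hext, hD (fun s => L (ρ s)) fun s => hLj _]
    rfl
  rw [Finset.sum_congr rfl fun ρ _ => hsum ρ, sum_orderEmbedding (fun ρ =>
      minor c r₁ (Function.extend ρ (fun s => P (Fin.castLE hk s)) L) *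
        if ∀ s, InRange r₂.i r₁.j (L (ρ s)) then
          minor c r₂ (fun b => if h : b.val < k then L (ρ ⟨b.val, h⟩) else P b) else 0)] at key
  change minor c r₁ L * _ = _ at key
  rw [pluckerRelation, map_sub, map_sum, sub_eq_zero]
  simp only [apply_ite (cellHom c t), map_mul, map_zero, cellHom_X]
  have hfin := congrArg (fun z => t r₁ * t r₂ * z) key
  simp only [Finset.mul_sum] at hfin
  calc _ = t r₁ * t r₂ * (minor c r₁ L *
        if ∀ s, InRange r₂.i r₁.j (P (Fin.castLE hk s)) then minor c r₂ P else 0) := by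
        split_ifs <;> ring
    _ = _ := hfin
    _ = _ := by
        refine Finset.sum_congr rfl fun ρ _ => ?_
        by_cases h1 : StrictMono ρ <;> by_cases h2 : ∀ s, InRange r₂.i r₁.j (L (ρ s))
        · rw [if_pos h1, if_pos h2, if_pos ⟨h1, h2⟩]; ring
        · rw [if_pos h1, if_neg h2, if_neg fun h => h2 h.2]; ring
        · rw [if_neg h1, if_neg fun h => h1 h.1]; ring
        · rw [if_neg h1, if_neg fun h => h1 h.1]; ring

theorem genericHom_of_mem_pluckerIdeal {F : PolyRing n} (hF : F ∈ pluckerIdeal n) :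
    genericHom n F = 0 := by
  have : pluckerIdeal n ≤ RingHom.ker (genericHom n) := by
    rw [pluckerIdeal, Ideal.span_le]
    rintro _ ⟨r₁, r₂, k, hk, L, P, h, rfl⟩
    exact genericHom_eq_zero fun c t => cellHom_pluckerRelation hk h c t
  exact this hF

/-- The ideal of the open cell is the saturation of the ideal of Plücker relations. -/
theorem genericHom_eq_zero_iff (F : PolyRing n) :
    genericHom n F = 0 ↔
      ∃ N : PosRoot n → ℕ, (∏ r, topX r ^ N r) * F ∈ pluckerIdeal n := by
  refine ⟨exists_mul_mem_pluckerIdeal, ?_⟩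
  rintro ⟨N, hN⟩
  have h := genericHom_of_mem_pluckerIdeal hN
  rw [map_mul, map_prod, mul_eq_zero] at h
  refine h.resolve_left ?_
  refine Finset.prod_ne_zero_iff.2 fun r _ => ?_
  rw [map_pow]
  refine pow_ne_zero _ ?_
  rw [genericHom, cellHom_topX]
  exact MvPolynomial.X_ne_zero _

end Relations

/-! ### Root vectors as infinitesimal translations of the cell. -/

section Invariance

variable {n : ℕ} {R : Type*} [CommRing R]

/-- The coordinates `c` of a point of the open cell with `z` added to the coordinate of `α_{a,b}`. -/
def shiftCoord (c : ℕ → ℕ → R) (s : PosRoot n) (z : R) : ℕ → ℕ → R :=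
  fun a x => c a x + if a + 1 = s.i ∧ x = s.j then z else 0

theorem castLE_source {r s : PosRoot n} (hi : s.i ≤ r.i) :
    Fin.castLE r.i_le ⟨s.i - 1, by have := s.i_pos; omega⟩ = s.source := rfl

theorem cellVec_shiftCoord_of_ne (c : ℕ → ℕ → R) {r s : PosRoot n} (z : R) (x : Fin n)
    (h : ¬(s.i ≤ r.i ∧ r.j ≤ s.j ∧ x = s.target)) :
    cellVec (shiftCoord c s z) r x = cellVec c r x := by
  ext a
  have ha := a.isLt
  simp only [cellVec]
  split_ifs with h1 h2 h3
  · rfl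
  · rfl
  · rw [shiftCoord, if_neg, add_zero]
    rintro ⟨h4, h5⟩
    exact h ⟨by omega, by omega, Fin.ext h5⟩
  · rfl

theorem cellVec_shiftCoord_target (c : ℕ → ℕ → R) {r s : PosRoot n} (z : R) (hi : s.i ≤ r.i)
    (hj : r.j ≤ s.j) :
    cellVec (shiftCoord c s z) r s.target =
      cellVec c r s.target + z • cellVec c r s.source := by
  have hp := s.i_pos
  rw [← castLE_source hi, cellVec_of_lt, cellVec_of_le _ _ _ (show r.j ≤ s.target.val from hj),
    cellVec_of_le _ _ _ (show r.j ≤ s.target.val from hj)]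
  ext a
  simp only [shiftCoord, Pi.add_apply, Pi.smul_apply, smul_eq_mul, Pi.single_apply, Fin.ext_iff,
    mul_ite, mul_one, mul_zero]
  congr 1
  have : (a.val + 1 = s.i ∧ s.target.val = s.j) ↔ a.val = s.i - 1 := by
    refine ⟨fun h => by omega, fun h => ⟨by omega, rfl⟩⟩
  simp only [this]

/-- In components with a ≤ i ≤ j ≤ b the shift adds `z` times the unit column `a` to the column b+1;
elsewhere nothing changes. As `L` is injective, that column occurs at most once, so the minor is
affine in `z` with no higher terms. -/
theorem minor_shiftCoord (c : ℕ → ℕ → R) (r s : PosRoot n) (z : R) (L : Fin r.i → Fin n)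
    (hL : Function.Injective L) :
    minor (shiftCoord c s z) r L = minor c r L + z * (if s.i ≤ r.i ∧ r.j ≤ s.j then
      ∑ t : Fin r.i, if L t = s.target then minor c r (Function.update L t s.source) else 0
      else 0) := by
  by_cases h : s.i ≤ r.i ∧ r.j ≤ s.j
  · rw [if_pos h]
    by_cases hex : ∃ t, L t = s.target
    · obtain ⟨t, ht⟩ := hex
      rw [Finset.sum_eq_single t, if_pos ht]
      · have h1 : (fun b => cellVec (shiftCoord c s z) r (L b)) =
            Function.update (fun b => cellVec c r (L b)) t
              (cellVec c r (L t) + z • cellVec c r s.source) := by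
          funext b
          by_cases hb : b = t
          · subst hb
            rw [Function.update_self, ht, cellVec_shiftCoord_target c z h.1 h.2]
          · rw [Function.update_of_ne hb, cellVec_shiftCoord_of_ne]
            rintro ⟨-, -, h'⟩
            exact hb (hL (h'.trans ht.symm))
        have h2 : Function.update (fun b => cellVec c r (L b)) t (cellVec c r s.source) =
            fun b => cellVec c r (Function.update L t s.source b) := by
          funext b
          by_cases hb : b = t
          · subst hb; simp
          · simp [hb]
        rw [minor, h1, AlternatingMap.map_update_add, AlternatingMap.map_update_smul, h2,
          Function.update_eq_self t (fun b => cellVec c r (L b)), smul_eq_mul]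
        rfl
      · intro b _ hb
        rw [if_neg]
        exact fun h' => hb (hL (h'.trans ht.symm))
      · simp
    · rw [Finset.sum_eq_zero fun t _ => if_neg fun ht => hex ⟨t, ht⟩, mul_zero, add_zero, minor,
        minor]
      congr 1
      funext b
      exact cellVec_shiftCoord_of_ne _ _ _ fun h' => hex ⟨b, h'.2.2⟩
  · rw [if_neg h, mul_zero, add_zero, minor, minor]
    congr 1
    funext b
    exact cellVec_shiftCoord_of_ne _ _ _ fun h' => h ⟨h'.1, h'.2.1⟩

/-- The action of a root vector is the infinitesimal translation of the open cell. -/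
theorem cellHom_dualNumber (c : ℕ → ℕ → ℂ) (t : PosRoot n → ℂ) (s : PosRoot n) (F : PolyRing n) :
    cellHom (R := DualNumber ℂ)
      (shiftCoord (fun a b => TrivSqZeroExt.inl (c a b)) s (TrivSqZeroExt.inr (-1)))
      (fun r => TrivSqZeroExt.inl (t r)) F =
    TrivSqZeroExt.inl (cellHom c t F) + TrivSqZeroExt.inr (cellHom c t (rootAct s F)) := by
  induction F using MvPolynomial.induction_on with
  | C a =>
    have h1 : (MvPolynomial.C a : PolyRing n) = algebraMap ℂ _ a := rfl
    rw [h1, AlgHom.commutes, AlgHom.commutes, Derivation.map_algebraMap, map_zero]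
    simp [TrivSqZeroExt.algebraMap_eq_inl]
  | add p q hp hq =>
    rw [map_add, hp, hq, map_add, map_add, map_add, TrivSqZeroExt.inl_add, TrivSqZeroExt.inr_add]
    abel
  | mul_X p x hp =>
    obtain ⟨r, L, hL⟩ := x
    have hm : ∀ l : Fin r.i → Fin n,
        minor (fun a b => (TrivSqZeroExt.inl (c a b) : DualNumber ℂ)) r l =
          TrivSqZeroExt.inl (minor c r l) := fun l =>
      (minor_map (TrivSqZeroExt.inlHom ℂ ℂ) c r l).symm
    have hX : cellHom c t (rootAct s (MvPolynomial.X ⟨r, L, hL⟩)) =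
        t r * -(if s.i ≤ r.i ∧ r.j ≤ s.j then
          ∑ d : Fin r.i, if L d = s.target then minor c r (Function.update L d s.source) else 0
          else 0) := by
      rw [rootAct, MvPolynomial.mkDerivation_X, rootActVar]
      split_ifs
      · rw [map_neg, map_sum, mul_neg, Finset.mul_sum]
        congr 1
        refine Finset.sum_congr rfl fun d _ => ?_
        dsimp only
        split_ifs
        · rw [cellHom_X]
        · simp
      · simp
    have hX' : cellHom (R := DualNumber ℂ)
        (shiftCoord (fun a b => TrivSqZeroExt.inl (c a b)) s (TrivSqZeroExt.inr (-1)))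
        (fun r => TrivSqZeroExt.inl (t r)) (MvPolynomial.X ⟨r, L, hL⟩) =
        TrivSqZeroExt.inl (cellHom c t (MvPolynomial.X ⟨r, L, hL⟩)) +
          TrivSqZeroExt.inr (cellHom c t (rootAct s (MvPolynomial.X ⟨r, L, hL⟩))) := by
      rw [hX, ← X_of_strictMono r L hL, cellHom_X, cellHom_X, minor_shiftCoord _ _ _ _ _ hL.1.injective,
        hm]
      simp only [hm]
      split_ifs
      · have : ∑ d : Fin r.i, (if L d = s.target then
            (TrivSqZeroExt.inl (minor c r (Function.update L d s.source)) : DualNumber ℂ) else 0) =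
            TrivSqZeroExt.inl (∑ d : Fin r.i,
              if L d = s.target then minor c r (Function.update L d s.source) else 0) := by
          rw [← TrivSqZeroExt.inlHom_apply, map_sum]
          refine Finset.sum_congr rfl fun d _ => ?_
          split_ifs <;> simp
        rw [this]
        ext <;> simp
      · simp
    rw [map_mul, hp, hX', map_mul, Derivation.leibniz]
    ext
    · simp
    · simp
      exact mul_comm _ _

/-- The kernel also vanishes at cell points over the dual numbers. The infinitesimal part at the
point shifted by -ε is the value of `rootAct s F`. -/
theorem genericHom_rootAct {F : PolyRing n} (hF : genericHom n F = 0) (s : PosRoot n) :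
    genericHom n (rootAct s F) = 0 := by
  refine genericHom_eq_zero fun c t => ?_
  have h := cellHom_dualNumber c t s F
  rw [cellHom_eq_zero hF] at h
  simpa using (congrArg TrivSqZeroExt.snd h).symm

theorem genericHom_nMinusAct {F : PolyRing n} (hF : genericHom n F = 0) (c : NMinus n) :
    genericHom n (nMinusAct c F) = 0 := by
  have : nMinusAct c F = ∑ s, c s • rootAct s F := by
    rw [nMinusAct]
    let ev : Derivation ℂ (PolyRing n) (PolyRing n) →+ PolyRing n :=
      { toFun := fun D => D F, map_zero' := rfl, map_add' := fun _ _ => rfl }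
    exact map_sum ev _ _
  rw [this, map_sum]
  refine Finset.sum_eq_zero fun s _ => ?_
  rw [map_smul, genericHom_rootAct hF, smul_zero]

end Invariance

/-! ### Points of R_n with nonzero largest coordinates. -/

section Points

variable {n : ℕ}

theorem mem_coordSubspace_iff (r : PosRoot n) (w : W n) :
    w ∈ coordSubspace r ↔ ∀ x, ¬InRange r.i r.j x → w x = 0 := by
  constructor
  · intro hw x hx
    have : coordSubspace r ≤ LinearMap.ker (LinearMap.proj (R := ℂ) (φ := fun _ : Fin n => ℂ) x) := by
      rw [coordSubspace, Submodule.span_le]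
      rintro _ ⟨y, hy, rfl⟩
      have : x ≠ y := by rintro rfl; exact hx hy
      simp [this]
    exact this hw
  · intro h
    rw [pi_eq_sum_univ' w]
    refine Submodule.sum_mem _ fun x _ => ?_
    by_cases hx : InRange r.i r.j x
    · exact Submodule.smul_mem _ _ (Submodule.subset_span ⟨x, hx, rfl⟩)
    · rw [h x hx, zero_smul]; exact Submodule.zero_mem _

theorem linearIndependent_of_minor_ne_zero {m : ℕ} (v : Fin m → W n) (L : Fin m → Fin n)
    (h : (Matrix.of fun a b => v a (L b)).det ≠ 0) : LinearIndependent ℂ v := by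
  have := Matrix.linearIndependent_rows_of_det_ne_zero h
  exact LinearIndependent.of_comp (LinearMap.funLeft ℂ ℂ L) this

/-- The rows of the matrix of a point of the open cell. -/
def cellRow (c : ℕ → ℕ → ℂ) (r : PosRoot n) (a : Fin r.i) : W n := fun x => cellVec c r x a

theorem det_cellRow (c : ℕ → ℕ → ℂ) (r : PosRoot n) (L : Fin r.i → Fin n) :
    (Matrix.of fun a b => cellRow c r a (L b)).det = minor c r L := by
  rw [← Matrix.det_transpose]
  rfl

theorem linearIndependent_cellRow (c : ℕ → ℕ → ℂ) (r : PosRoot n) :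
    LinearIndependent ℂ (cellRow c r) := by
  refine linearIndependent_of_minor_ne_zero _ (Fin.castLE r.i_le) ?_
  rw [det_cellRow, minor_top]
  exact one_ne_zero

/-- The numbers `c` do not depend on the component: row `a` is literally the same in (i,j) and
(i+1,j), and passing to (i,j+1) only erases the entry at w_{j+1}. -/
theorem cell_mem_Rn (c : ℕ → ℕ → ℂ) :
    (fun r : PosRoot n => Submodule.span ℂ (Set.range (cellRow c r))) ∈ Rn n := by
  refine ⟨fun r => ⟨?_, ?_⟩, fun r s hi hj => ?_, fun r s hi hj => ?_⟩
  · rw [finrank_span_eq_card (linearIndependent_cellRow c r), Fintype.card_fin]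
  · rw [Submodule.span_le]
    rintro _ ⟨a, rfl⟩
    rw [SetLike.mem_coe, mem_coordSubspace_iff]
    intro x hx
    rw [cellRow, cellVec_of_not_inRange c r x hx]
    rfl
  · rw [Submodule.span_le]
    rintro _ ⟨a, rfl⟩
    refine Submodule.subset_span ⟨Fin.castLE (by omega) a, ?_⟩
    have := s.i_le_j
    have := a.isLt
    ext x
    simp only [cellRow, cellVec, Fin.val_castLE]
    split_ifs <;> first | rfl | omega
  · rw [Submodule.map_span_le]
    rintro _ ⟨a, rfl⟩
    refine Submodule.subset_span ⟨Fin.castLE (by omega) a, ?_⟩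
    have := r.i_le_j
    ext x
    change _ = Function.update (cellRow c r a) _ 0 x
    rw [Function.update_apply]
    simp only [cellRow, cellVec, Fin.val_castLE, Fin.ext_iff]
    split_ifs <;> first | rfl | omega

theorem eval_scale {F : PolyRing n} {m : PosRoot n → ℕ} (hF : IsMultihomogeneous F m)
    (t : PosRoot n → ℂ) (p : PluckerVar n → ℂ) :
    MvPolynomial.eval (fun x => t x.1 * p x) F = (∏ r, t r ^ m r) * MvPolynomial.eval p F := by
  rw [MvPolynomial.eval_eq, MvPolynomial.eval_eq, Finset.mul_sum]
  refine Finset.sum_congr rfl fun d hd => ?_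
  have hm := hF (MvPolynomial.mem_support_iff.1 hd)
  simp only [mul_pow]
  rw [Finset.prod_mul_distrib, mul_left_comm]
  congr 1
  have hmr : ∀ r, m r = ∑ x ∈ d.support, d x * (Pi.single x.1 1 : PosRoot n → ℕ) r := by
    intro r
    rw [← hm, Finsupp.weight_apply, Finsupp.sum, Finset.sum_apply]
    rfl
  simp_rw [hmr, ← Finset.prod_pow_eq_pow_sum]
  rw [Finset.prod_comm]
  refine Finset.prod_congr rfl fun x _ => ?_
  rw [Finset.prod_eq_single x.1]
  · simp
  · intro r _ hr
    simp [hr]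
  · simp

theorem cellHom_eq_eval {F : PolyRing n} {m : PosRoot n → ℕ} (hF : IsMultihomogeneous F m)
    (c : ℕ → ℕ → ℂ) (t : PosRoot n → ℂ) :
    cellHom c t F = (∏ r, t r ^ m r) * MvPolynomial.eval (fun x => minor c x.1 x.2.1) F := by
  rw [← eval_scale hF, cellHom, MvPolynomial.aeval_eq_eval]

theorem genericHom_of_mem_vanishingIdeal {F : PolyRing n} (hF : F ∈ vanishingIdeal n) :
    genericHom n F = 0 := by
  have : vanishingIdeal n ≤ RingHom.ker (genericHom n) := by
    rw [vanishingIdeal, Ideal.span_le]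
    rintro G ⟨⟨m, hm⟩, hG⟩
    refine genericHom_eq_zero fun c t => ?_
    have := hG _ (cell_mem_Rn c) (fun r => cellRow c r) fun r => ⟨linearIndependent_cellRow c r, rfl⟩
    have hp : pluckerCoord (fun r => cellRow c r) = fun x : PluckerVar n => minor c x.1 x.2.1 := by
      funext x
      exact det_cellRow c x.1 x.2.1
    rw [hp] at this
    rw [cellHom_eq_eval hm, this, mul_zero]
  exact this hF

/-- The reduced row echelon form of a basis with non-zero first minor. -/
theorem exists_reduced_rows {m : ℕ} (hm : m ≤ n) (v : Fin m → W n)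
    (h : (Matrix.of fun a b => v a (Fin.castLE hm b)).det ≠ 0) :
    ∃ B : Fin m → W n, (∀ a, B a ∈ Submodule.span ℂ (Set.range v)) ∧
      (∀ a b, B a (Fin.castLE hm b) = if a = b then 1 else 0) ∧
      (∀ w ∈ Submodule.span ℂ (Set.range v), w = ∑ a, w (Fin.castLE hm a) • B a) ∧
      ∀ L : Fin m → Fin n, (Matrix.of fun a b => v a (L b)).det =
        (Matrix.of fun a b => v a (Fin.castLE hm b)).det * (Matrix.of fun a b => B a (L b)).det := by
  set A : Matrix (Fin m) (Fin m) ℂ := Matrix.of fun a b => v a (Fin.castLE hm b) with hA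
  set M : Matrix (Fin m) (Fin n) ℂ := Matrix.of v with hM
  have hu : IsUnit A.det := isUnit_iff_ne_zero.2 h
  let B : Matrix (Fin m) (Fin n) ℂ := A⁻¹ * M
  have hAB : A * B = M := by
    rw [← Matrix.mul_assoc, Matrix.mul_nonsing_inv A hu, Matrix.one_mul]
  have hB1 : ∀ a b, B a (Fin.castLE hm b) = if a = b then 1 else 0 := by
    intro a b
    have : B a (Fin.castLE hm b) = (A⁻¹ * A) a b := rfl
    rw [this, Matrix.nonsing_inv_mul A hu, Matrix.one_apply]
  refine ⟨fun a => B a, fun a => ?_, hB1, fun w hw => ?_, fun L => ?_⟩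
  · have : B a = ∑ d, A⁻¹ a d • v d := by
      ext x
      simp only [B, Matrix.mul_apply, Finset.sum_apply, Pi.smul_apply, smul_eq_mul]
      rfl
    change B a ∈ _
    rw [this]
    exact Submodule.sum_mem _ fun d _ => Submodule.smul_mem _ _ (Submodule.subset_span ⟨d, rfl⟩)
  · obtain ⟨y, rfl⟩ := (Submodule.mem_span_range_iff_exists_fun ℂ).1 hw
    have hv : ∀ d, v d = ∑ a, A d a • B a := by
      intro d
      have : v d = (A * B) d := by rw [hAB]; rfl
      rw [this]
      ext x
      simp only [Matrix.mul_apply, Finset.sum_apply, Pi.smul_apply, smul_eq_mul]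
    have hcoef : ∀ a, (∑ d, y d • v d) (Fin.castLE hm a) = ∑ d, y d * A d a := by
      intro a
      simp only [Finset.sum_apply, Pi.smul_apply, smul_eq_mul]
      rfl
    simp only [hcoef]
    simp only [Finset.sum_smul]
    rw [Finset.sum_comm]
    refine Finset.sum_congr rfl fun d _ => ?_
    conv_lhs => rw [hv d, Finset.smul_sum]
    simp only [smul_smul]
  · rw [← Matrix.det_mul]
    congr 1
    ext a b
    have : M a (L b) = (A * B) a (L b) := by rw [hAB]
    exact this

/-- The root `α_{i,j}`. -/
def mkRoot (i j : ℕ) (h₁ : 1 ≤ i) (h₂ : i ≤ j) (h₃ : j < n) : PosRoot n :=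
  ⟨(⟨i, by omega⟩, ⟨j, h₃⟩), h₁, h₂⟩

/-- A point of `R_n` with non-zero largest Plücker coordinates belongs to the open cell. -/
theorem exists_cell_coord {V : PosRoot n → Submodule ℂ (W n)} (hV : V ∈ Rn n)
    {v : (r : PosRoot n) → Fin r.i → W n} (hv : IsBasisFamily V v)
    (hdet : ∀ r, (Matrix.of fun a b => v r a (Fin.castLE r.i_le b)).det ≠ 0) :
    ∃ (c : ℕ → ℕ → ℂ) (t : PosRoot n → ℂ),
      pluckerCoord v = fun x => t x.1 * minor c x.1 x.2.1 := by
  have hex := fun r => exists_reduced_rows r.i_le (v r) (hdet r)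
  choose B hBmem hBtop hBspan hBdet using hex
  simp only [(hv _).2] at hBmem hBspan
  -- A vector of V_{i,j} is determined by its first i coordinates, so reduced rows of neighbouring
  -- components can be identified by comparing those.
  have huniq : ∀ (r : PosRoot n) (a : Fin r.i) (w : W n), w ∈ V r →
      (∀ b, w (Fin.castLE r.i_le b) = if a = b then 1 else 0) → w = B r a := by
    intro r a w hw h
    rw [hBspan r w hw]
    simp only [h]
    simp
  have hstep₁ : ∀ (r s : PosRoot n) (hi : s.i = r.i + 1) (_ : s.j = r.j) (a : Fin r.i),
      B r a = B s (Fin.castLE (by omega) a) := by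
    intro r s hi hj a
    refine huniq s _ _ (hV.2.1 r s hi hj (hBmem r a)) fun b => ?_
    by_cases hb : b.val < r.i
    · have := hBtop r a ⟨b.val, hb⟩
      rw [show Fin.castLE s.i_le b = Fin.castLE r.i_le ⟨b.val, hb⟩ from rfl, this]
      simp [Fin.ext_iff]
    · have h1 := (mem_coordSubspace_iff r _).1 ((hV.1 r).2 (hBmem r a)) (Fin.castLE s.i_le b) (by
        have := s.i_le_j
        have := b.isLt
        rintro (h | h) <;> simp at h <;> omega)
      rw [h1, if_neg]
      rintro rfl
      exact hb (by simp)
  have hstep₂ : ∀ (r s : PosRoot n) (hi : s.i = r.i) (_ : s.j = r.j + 1) (a : Fin r.i) (x : Fin n),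
      x.val ≠ r.j → B r a x = B s (Fin.castLE (by omega) a) x := by
    intro r s hi hj a x hx
    have hmem : proj ⟨r.j, r.j_lt⟩ (B r a) ∈ V s :=
      hV.2.2 r s hi hj (Submodule.mem_map_of_mem (hBmem r a))
    have hproj : ∀ y : Fin n, y.val ≠ r.j → proj ⟨r.j, r.j_lt⟩ (B r a) y = B r a y := by
      intro y hy
      exact Function.update_of_ne (fun h => hy (congrArg Fin.val h)) _ _
    rw [← huniq s (Fin.castLE (by omega) a) _ hmem, hproj x hx]
    intro b
    have hb : b.val < r.i := by omega
    have := r.i_le_j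
    rw [hproj _ (by simp; omega)]
    have := hBtop r a ⟨b.val, hb⟩
    rw [show Fin.castLE s.i_le b = Fin.castLE r.i_le ⟨b.val, hb⟩ from rfl, this]
    simp [Fin.ext_iff]
  -- Total functions on ℕ avoid casts between the types `Fin r.i` in the inductions below.
  let β : ℕ → ℕ → ℕ → ℕ → ℂ := fun i j a x =>
    if h : (1 ≤ i ∧ i ≤ j ∧ j < n) ∧ a < i ∧ x < n then
      B (mkRoot i j h.1.1 h.1.2.1 h.1.2.2) ⟨a, h.2.1⟩ ⟨x, h.2.2⟩ else 0
  have hβ : ∀ (r : PosRoot n) (a : Fin r.i) (x : Fin n), B r a x = β r.i r.j a x := by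
    intro r a x
    simp only [β]
    rw [dif_pos ⟨⟨r.i_pos, r.i_le_j, r.j_lt⟩, a.isLt, x.isLt⟩]
    rfl
  have hβ₁ : ∀ i j a x, 1 ≤ i → i + 1 ≤ j → j < n → a < i → x < n →
      β i j a x = β (i + 1) j a x := by
    intro i j a x h1 h2 h3 h4 h5
    have := hstep₁ (mkRoot i j h1 (by omega) h3) (mkRoot (i + 1) j (by omega) h2 h3) rfl rfl ⟨a, h4⟩
    have := congrFun this ⟨x, h5⟩
    rw [hβ, hβ] at this
    exact this
  have hβ₂ : ∀ i j a x, 1 ≤ i → i ≤ j → j + 1 < n → a < i → x < n → x ≠ j →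
      β i j a x = β i (j + 1) a x := by
    intro i j a x h1 h2 h3 h4 h5 h6
    have := hstep₂ (mkRoot i j h1 h2 (by omega)) (mkRoot i (j + 1) h1 (by omega) h3) rfl rfl ⟨a, h4⟩
      ⟨x, h5⟩ h6
    rw [hβ, hβ] at this
    exact this
  have hup : ∀ a x i, x < n → a + 1 ≤ i → i ≤ x → β (a + 1) x a x = β i x a x := by
    intro a x i hx hi
    induction i, hi using Nat.le_induction with
    | base => exact fun _ => rfl
    | succ i hi ih =>
      intro h
      rw [ih (by omega), hβ₁ i x a x (by omega) h hx (by omega) hx]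
  -- Raising j up to x never erases the entry in column x. Together with `hup`, entry (a,x) of
  -- component (i,j) is that of (i,x), and then that of (a+1,x), which gives the common coordinate.
  have hright : ∀ a i d j x, x = j + d → x < n → a < i → i ≤ j → β i j a x = β i x a x := by
    intro a i d
    induction d with
    | zero => intro j x h _ _ _; rw [h]; rfl
    | succ d ih =>
      intro j x h hx ha hi
      rw [hβ₂ i j a x (by omega) hi (by omega) ha hx (by omega)]
      exact ih (j + 1) x (by omega) hx ha (by omega)
  refine ⟨fun a x => β (a + 1) x a x,
    fun r => (Matrix.of fun a b => v r a (Fin.castLE r.i_le b)).det, ?_⟩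
  funext x
  obtain ⟨r, L, hL⟩ := x
  have hrow : ∀ a, B r a = cellRow (fun a x => β (a + 1) x a x) r a := by
    intro a
    have hij := r.i_le_j
    have ha := a.isLt
    ext y
    simp only [cellRow, cellVec]
    split_ifs with h1 h2 h3
    · have := hBtop r a ⟨y.val, h1⟩
      rw [if_pos (Fin.ext h2)] at this
      exact this
    · have := hBtop r a ⟨y.val, h1⟩
      rw [if_neg fun h => h2 (congrArg Fin.val h)] at this
      exact this
    · rw [hβ, hup a y r.i y.isLt (by omega) (by omega)]
      exact hright a r.i (y.val - r.j) r.j y (by omega) y.isLt ha hij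
    · exact (mem_coordSubspace_iff r _).1 ((hV.1 r).2 (hBmem r a)) y (by
        rintro (h | h)
        · exact h1 h
        · exact h3 h)
  have := hBdet r L
  simp only [hrow] at this
  rw [det_cellRow] at this
  exact this

end Points

/-! ### One-dimensional steps of flags, and the flag completed at its boundary. -/

section Curve

theorem eq_sup_span_singleton {K E : Type*} [Field K] [AddCommGroup E] [Module K E]
    [FiniteDimensional K E] {A C : Submodule K E} (hAC : A ≤ C)
    (h : Module.finrank K C = Module.finrank K A + 1) {z : E} (hz : z ∈ C) (hzA : z ∉ A) :
    C = A ⊔ Submodule.span K {z} := by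
  symm
  have hle : A ⊔ Submodule.span K {z} ≤ C :=
    sup_le hAC ((Submodule.span_singleton_le_iff_mem z C).2 hz)
  apply Submodule.eq_of_le_of_finrank_le hle
  have hlt : A < A ⊔ Submodule.span K {z} := by
    refine lt_of_le_of_ne le_sup_left fun heq => hzA ?_
    rw [heq]
    exact Submodule.mem_sup_right (Submodule.mem_span_singleton_self z)
  have := Submodule.finrank_lt_finrank_of_lt hlt
  omega

/-- A flag `A ⊂ C ⊂ B` with one-dimensional quotients and `B = A + ⟨y, u⟩` is given by a `2 × 2`
matrix. -/
theorem exists_flag_matrix {K E : Type*} [Field K] [AddCommGroup E] [Module K E]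
    [FiniteDimensional K E] {A C B : Submodule K E} (hAC : A ≤ C) (hCB : C ≤ B)
    (h₁ : Module.finrank K C = Module.finrank K A + 1)
    (h₂ : Module.finrank K B = Module.finrank K C + 1) {y u : E} (hy : y ∈ B) (hu : u ∈ B)
    (hB : B ≤ A ⊔ Submodule.span K {y} ⊔ Submodule.span K {u}) :
    ∃ α β γ δ : K, C = A ⊔ Submodule.span K {α • u + β • y} ∧
      B = C ⊔ Submodule.span K {γ • u + δ • y} := by
  have hz : ∃ z ∈ C, z ∉ A := by
    by_contra hcon
    push Not at hcon
    have := Submodule.finrank_mono (show C ≤ A from hcon)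
    omega
  obtain ⟨z, hzC, hzA⟩ := hz
  obtain ⟨p, hp, q, hq, rfl⟩ := Submodule.mem_sup.1 (hB (hCB hzC))
  obtain ⟨a, ha, q', hq', rfl⟩ := Submodule.mem_sup.1 hp
  obtain ⟨α, rfl⟩ := Submodule.mem_span_singleton.1 hq
  obtain ⟨β, rfl⟩ := Submodule.mem_span_singleton.1 hq'
  have e : α • u + β • y = (a + β • y + α • u) - a := by abel
  have hC : C = A ⊔ Submodule.span K {α • u + β • y} := by
    apply eq_sup_span_singleton hAC h₁
    · rw [e]; exact C.sub_mem hzC (hAC ha)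
    · intro h
      apply hzA
      have : a + β • y + α • u = a + (α • u + β • y) := by abel
      rw [this]
      exact A.add_mem ha h
  by_cases huC : u ∈ C
  · refine ⟨α, β, 0, 1, hC, ?_⟩
    rw [zero_smul, one_smul, zero_add]
    refine eq_sup_span_singleton hCB h₂ hy fun hyC => ?_
    have : B ≤ C := hB.trans (sup_le (sup_le hAC
      ((Submodule.span_singleton_le_iff_mem y C).2 hyC))
      ((Submodule.span_singleton_le_iff_mem u C).2 huC))
    have := Submodule.finrank_mono this
    omega
  · refine ⟨α, β, 1, 0, hC, ?_⟩
    rw [zero_smul, one_smul, add_zero]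
    exact eq_sup_span_singleton hCB h₂ hu huC

theorem exists_dependent_seq {α : Type*} (P : ℕ → α → Prop) (R : ℕ → α → α → Prop)
    (h₀ : ∃ x, P 0 x) (hs : ∀ d x, P d x → ∃ y, P (d + 1) y ∧ R d x y) :
    ∃ f : ℕ → α, (∀ d, P d (f d)) ∧ ∀ d, R d (f d) (f (d + 1)) := by
  choose! g hg using hs
  obtain ⟨x₀, hx₀⟩ := h₀
  let f : ℕ → α := fun d => Nat.rec x₀ (fun d x => g d x) d
  have hf : ∀ d, P d (f d) := by
    intro d
    induction d with
    | zero => exact hx₀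
    | succ d ih => exact (hg d _ ih).1
  exact ⟨f, hf, fun d => (hg d _ (hf d)).2⟩

variable {n : ℕ}

/-- The basis vector of `W` with index `a`; it is zero for `a ≥ n`. -/
def basisVec (n a : ℕ) : W n := fun x => if x.val = a then 1 else 0

/-- The subspaces `V_{i,j}` of a point of `R_n`, completed by `V_{0,j} = 0` and
`V_{i,n} = span (w_1, …, w_i)`. -/
def extendedFlag (V : PosRoot n → Submodule ℂ (W n)) (i j : ℕ) : Submodule ℂ (W n) :=
  if h : 1 ≤ i ∧ i ≤ j ∧ j < n then V (mkRoot i j h.1 h.2.1 h.2.2)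
  else if n ≤ j then Submodule.span ℂ (Set.range fun a : Fin i => basisVec n a) else ⊥

theorem extendedFlag_root (V : PosRoot n → Submodule ℂ (W n)) (r : PosRoot n) :
    extendedFlag V r.i r.j = V r := by
  rw [extendedFlag, dif_pos ⟨r.i_pos, r.i_le_j, r.j_lt⟩]
  rfl

theorem extendedFlag_zero (V : PosRoot n → Submodule ℂ (W n)) (j : ℕ) :
    extendedFlag V 0 j = ⊥ := by
  rw [extendedFlag, dif_neg (by omega)]
  split_ifs
  · simp
  · rfl

theorem extendedFlag_last (V : PosRoot n → Submodule ℂ (W n)) (i : ℕ) :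
    extendedFlag V i n = Submodule.span ℂ (Set.range fun a : Fin i => basisVec n a) := by
  rw [extendedFlag, dif_neg (by omega), if_pos le_rfl]

theorem linearIndependent_basisVec {i : ℕ} (hi : i ≤ n) :
    LinearIndependent ℂ fun a : Fin i => basisVec n a := by
  refine linearIndependent_of_minor_ne_zero _ (Fin.castLE hi) ?_
  have : (Matrix.of fun a b : Fin i => basisVec n a (Fin.castLE hi b)) = 1 := by
    ext a b
    simp [basisVec, Matrix.one_apply, Fin.ext_iff, eq_comm]
  rw [this, Matrix.det_one]
  exact one_ne_zero

theorem apply_eq_zero_of_mem_span {S : Set (W n)} (x : Fin n) (h : ∀ w ∈ S, w x = 0)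
    {w : W n} (hw : w ∈ Submodule.span ℂ S) : w x = 0 := by
  have : Submodule.span ℂ S ≤
      LinearMap.ker (LinearMap.proj (R := ℂ) (φ := fun _ : Fin n => ℂ) x) := by
    rw [Submodule.span_le]
    exact fun w hw => h w hw
  exact this hw


theorem finrank_extendedFlag {V : PosRoot n → Submodule ℂ (W n)} (hV : V ∈ Rn n) {i j : ℕ}
    (hij : i ≤ j) (hj : j ≤ n) : Module.finrank ℂ (extendedFlag V i j) = i := by
  rcases Nat.eq_zero_or_pos i with rfl | hi
  · rw [extendedFlag_zero, finrank_bot]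
  rcases hj.lt_or_eq with hj | rfl
  · exact (extendedFlag_root V (mkRoot i j hi hij hj)) ▸ (hV.1 (mkRoot i j hi hij hj)).1
  · rw [extendedFlag_last, finrank_span_eq_card (linearIndependent_basisVec hij), Fintype.card_fin]

theorem extendedFlag_mono {V : PosRoot n → Submodule ℂ (W n)} (hV : V ∈ Rn n) {i j : ℕ}
    (hij : i + 1 ≤ j) (hj : j ≤ n) : extendedFlag V i j ≤ extendedFlag V (i + 1) j := by
  rcases Nat.eq_zero_or_pos i with rfl | hi
  · rw [extendedFlag_zero]; exact bot_le
  rcases hj.lt_or_eq with hj | rfl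
  · have := hV.2.1 (mkRoot i j hi (by omega) hj) (mkRoot (i + 1) j (by omega) hij hj) rfl rfl
    rw [← extendedFlag_root V (mkRoot i j hi (by omega) hj),
      ← extendedFlag_root V (mkRoot (i + 1) j (by omega) hij hj)] at this
    exact this
  · rw [extendedFlag_last, extendedFlag_last]
    apply Submodule.span_mono
    rintro _ ⟨a, rfl⟩
    exact ⟨a.castSucc, rfl⟩

theorem apply_eq_zero_of_mem_extendedFlag {V : PosRoot n → Submodule ℂ (W n)} (hV : V ∈ Rn n)
    {i j : ℕ} (hij : i ≤ j) (hj : j ≤ n) {w : W n} (hw : w ∈ extendedFlag V i j) (x : Fin n)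
    (hix : i ≤ x.val) (hxj : x.val < j) : w x = 0 := by
  rcases Nat.eq_zero_or_pos i with rfl | hi
  · rw [extendedFlag_zero, Submodule.mem_bot] at hw
    rw [hw]; rfl
  rcases hj.lt_or_eq with hj | rfl
  · have h := extendedFlag_root V (mkRoot i j hi hij hj)
    change extendedFlag V i j = _ at h
    rw [h] at hw
    refine (mem_coordSubspace_iff _ _).1 ((hV.1 _).2 hw) x ?_
    rintro (h | h)
    · exact absurd hix (not_le.2 h)
    · exact absurd hxj (not_lt.2 h)
  · rw [extendedFlag_last] at hw
    refine apply_eq_zero_of_mem_span x ?_ hw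
    rintro _ ⟨a, rfl⟩
    have := a.isLt
    exact if_neg (by omega)

/-- A vector differs from its image under pr_{j+1} by a multiple of w_{j+1}. For j + 1 = n the image
has only its first i coordinates left, so it lies in the boundary space. -/
theorem extendedFlag_le_sup {V : PosRoot n → Submodule ℂ (W n)} (hV : V ∈ Rn n) {i j : ℕ}
    (hij : i ≤ j) (hj : j < n) :
    extendedFlag V i j ≤ extendedFlag V i (j + 1) ⊔ Submodule.span ℂ {basisVec n j} := by
  rcases Nat.eq_zero_or_pos i with rfl | hi
  · rw [extendedFlag_zero]; exact bot_le
  intro w hw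
  have hdecomp : w = proj ⟨j, hj⟩ w + w ⟨j, hj⟩ • basisVec n j := by
    ext x
    change _ = Function.update w ⟨j, hj⟩ 0 x + w ⟨j, hj⟩ * basisVec n j x
    by_cases hx : x = ⟨j, hj⟩
    · subst hx; simp [basisVec]
    · have : x.val ≠ j := fun h => hx (Fin.ext h)
      simp [basisVec, hx, this]
  rw [hdecomp]
  refine Submodule.add_mem_sup ?_ (Submodule.smul_mem _ _ (Submodule.mem_span_singleton_self _))
  have h := extendedFlag_root V (mkRoot i j hi hij hj)
  change extendedFlag V i j = _ at h
  rcases (show j + 1 ≤ n from hj).lt_or_eq with hj' | hj'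
  · have h' := extendedFlag_root V (mkRoot i (j + 1) hi (by omega) hj')
    change extendedFlag V i (j + 1) = _ at h'
    rw [h'] at *
    rw [h] at hw
    exact hV.2.2 (mkRoot i j hi hij hj) (mkRoot i (j + 1) hi (by omega) hj') rfl rfl
      (Submodule.mem_map_of_mem hw)
  · rw [hj', extendedFlag_last]
    have hsum : proj ⟨j, hj⟩ w = ∑ a : Fin i, w (Fin.castLE (by omega) a) • basisVec n a := by
      ext x
      change Function.update w ⟨j, hj⟩ 0 x = _
      simp only [Finset.sum_apply, Pi.smul_apply, smul_eq_mul, basisVec, mul_ite, mul_one, mul_zero]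
      by_cases hx : x.val < i
      · rw [Finset.sum_eq_single ⟨x.val, hx⟩]
        · rw [Function.update_of_ne (fun h => by have := congrArg Fin.val h; simp at this; omega)]
          simp
        · intro b _ hb
          rw [if_neg]
          exact fun h => hb (Fin.ext h.symm)
        · simp
      · rw [Finset.sum_eq_zero]
        · by_cases hxj : x = ⟨j, hj⟩
          · rw [hxj, Function.update_self]
          · rw [Function.update_of_ne hxj]
            refine apply_eq_zero_of_mem_extendedFlag hV hij hj.le hw x (by omega) ?_
            have : x.val ≠ j := fun h => hxj (Fin.ext h)
            omega
        · intro b _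
          rw [if_neg]
          omega
    rw [hsum]
    exact Submodule.sum_mem _ fun a _ => Submodule.smul_mem _ _ (Submodule.subset_span ⟨a, rfl⟩)

/-- The vector w_{j+1} is not in V_{i,j+1}, because the coordinate at w_{j+1} vanishes there. -/
theorem finrank_extendedFlag_sup {V : PosRoot n → Submodule ℂ (W n)} (hV : V ∈ Rn n) {i j : ℕ}
    (hij : i ≤ j) (hj : j < n) :
    Module.finrank ℂ
      (extendedFlag V i (j + 1) ⊔ Submodule.span ℂ {basisVec n j} : Submodule ℂ (W n)) = i + 1 := by
  have hb : basisVec n j ⟨j, hj⟩ = 1 := by simp [basisVec]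
  have hne : basisVec n j ≠ 0 := by
    intro h
    rw [h] at hb
    exact zero_ne_one hb
  have hdisj : extendedFlag V i (j + 1) ⊓ Submodule.span ℂ {basisVec n j} = ⊥ := by
    rw [eq_bot_iff]
    rintro w ⟨hw₁, hw₂⟩
    obtain ⟨μ, rfl⟩ := Submodule.mem_span_singleton.1 hw₂
    have := apply_eq_zero_of_mem_extendedFlag hV (by omega) hj hw₁ ⟨j, hj⟩ hij (by simp)
    rw [Pi.smul_apply, hb, smul_eq_mul, mul_one] at this
    rw [this, zero_smul]
    exact Submodule.zero_mem _
  have h := Submodule.finrank_sup_add_finrank_inf_eq (extendedFlag V i (j + 1))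
    (Submodule.span ℂ {basisVec n j})
  rw [hdisj, finrank_bot, finrank_extendedFlag hV (by omega) hj, finrank_span_singleton hne] at h
  exact h

end Curve

/-! ### Polynomial curves into the cell, density, and the ideal of R_n. -/

section Curve

variable {n : ℕ}

/-- The value at `s` of a vector with polynomial coordinates. -/
def evalVec (s : ℂ) (P : Fin n → Polynomial ℂ) : W n := fun x => (P x).eval s

theorem evalVec_add_smul (s : ℂ) (p q : Polynomial ℂ) (P Q : Fin n → Polynomial ℂ) :
    evalVec s (p • P + q • Q) = p.eval s • evalVec s P + q.eval s • evalVec s Q := by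
  ext x
  simp [evalVec]

/-- A vector with constant polynomial coordinates. -/
def constVec (w : W n) : Fin n → Polynomial ℂ := fun x => Polynomial.C (w x)

theorem evalVec_constVec (s : ℂ) (w : W n) : evalVec s (constVec w) = w := by
  ext x
  simp [evalVec, constVec]

/-- The span of the values at `s` of the first `i` members of a sequence of polynomial vectors. -/
def colSpan (s : ℂ) (U : ℕ → Fin n → Polynomial ℂ) (i : ℕ) : Submodule ℂ (W n) :=
  Submodule.span ℂ (Set.range fun a : Fin i => evalVec s (U a))

theorem evalVec_mem_colSpan (s : ℂ) (U : ℕ → Fin n → Polynomial ℂ) {a i : ℕ} (h : a < i) :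
    evalVec s (U a) ∈ colSpan s U i :=
  Submodule.subset_span ⟨⟨a, h⟩, rfl⟩

theorem colSpan_le {s : ℂ} {U : ℕ → Fin n → Polynomial ℂ} {i : ℕ} {S : Submodule ℂ (W n)}
    (h : ∀ a < i, evalVec s (U a) ∈ S) : colSpan s U i ≤ S := by
  rw [colSpan, Submodule.span_le]
  rintro _ ⟨a, rfl⟩
  exact h a a.isLt

theorem colSpan_mono (s : ℂ) (U : ℕ → Fin n → Polynomial ℂ) {i i' : ℕ} (h : i ≤ i') :
    colSpan s U i ≤ colSpan s U i' :=
  colSpan_le fun _ ha => evalVec_mem_colSpan s U (ha.trans_le h)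

/-- A sequence of polynomial vectors which connects the standard flag to the flag
`V_{1,j} ⊂ V_{2,j} ⊂ …`. -/
def IsColumn (V : PosRoot n → Submodule ℂ (W n)) (j : ℕ) (U : ℕ → Fin n → Polynomial ℂ) : Prop :=
  ∀ a < j, extendedFlag V (a + 1) j =
      extendedFlag V a j ⊔ Submodule.span ℂ {evalVec 1 (U a)} ∧
    evalVec 0 (U a) = basisVec n a ∧
    ∀ (s : ℂ) (x : Fin n), a < x.val → x.val < j → evalVec s (U a) x = 0

/-- The incidence relation between the sequences of vectors for `j` and for `j + 1`. -/
def IsNextColumn (j : ℕ) (U' U : ℕ → Fin n → Polynomial ℂ) : Prop :=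
  ∀ a < j, ∀ s, evalVec s (U a) ∈ colSpan s U' (a + 1) ⊔ Submodule.span ℂ {basisVec n j}

/-- V_{i,j} is a hyperplane in V_{i,j+1} + ⟨w_{j+1}⟩, and `Y` supplies a complement at s = 1. Then
V_{i,j} ⊂ V_{i+1,j} ⊂ V_{i+1,j+1} + ⟨w_{j+1}⟩ is a flag inside V_{i,j} + ⟨Y, U'_i⟩, described by a 2
× 2 matrix. Its first row yields the new vector `u`, its second the next complement. -/
theorem exists_column_entry {V : PosRoot n → Submodule ℂ (W n)} (hV : V ∈ Rn n) {j : ℕ}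
    (hj : j < n) {U' : ℕ → Fin n → Polynomial ℂ} (hU' : IsColumn V (j + 1) U') (i : ℕ)
    (hi : i ≤ j) : ∃ u Y : Fin n → Polynomial ℂ,
      extendedFlag V i (j + 1) ⊔ Submodule.span ℂ {basisVec n j} =
        extendedFlag V i j ⊔ Submodule.span ℂ {evalVec 1 Y} ∧
      (∀ s, evalVec s Y ∈ colSpan s U' i ⊔ Submodule.span ℂ {basisVec n j}) ∧
      ∀ a, i = a + 1 →
        extendedFlag V (a + 1) j = extendedFlag V a j ⊔ Submodule.span ℂ {evalVec 1 u} ∧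
        evalVec 0 u = basisVec n a ∧
        ∀ s, evalVec s u ∈ colSpan s U' (a + 1) ⊔ Submodule.span ℂ {basisVec n j} := by
  induction i with
  | zero =>
    refine ⟨0, constVec (basisVec n j), ?_, fun s => ?_, fun a ha => absurd ha (by omega)⟩
    · rw [extendedFlag_zero, extendedFlag_zero, evalVec_constVec]
    · rw [evalVec_constVec]
      exact Submodule.mem_sup_right (Submodule.mem_span_singleton_self _)
  | succ i ih =>
    obtain ⟨-, Y, hY, hYmem, -⟩ := ih (by omega)
    obtain ⟨hU'1, hU'2, -⟩ := hU' i (by omega)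
    have hmono : extendedFlag V i (j + 1) ≤ extendedFlag V (i + 1) (j + 1) :=
      extendedFlag_mono hV (by omega) hj
    obtain ⟨α, β, γ, δ, h1, h2⟩ := exists_flag_matrix
      (extendedFlag_mono hV (i := i) (j := j) hi hj.le) (extendedFlag_le_sup hV hi hj)
      (by rw [finrank_extendedFlag hV hi hj.le, finrank_extendedFlag hV (by omega) hj.le])
      (by rw [finrank_extendedFlag_sup hV hi hj, finrank_extendedFlag hV hi hj.le])
      (y := evalVec 1 Y) (u := evalVec 1 (U' i))
      (by
        have : evalVec 1 Y ∈ extendedFlag V i j ⊔ Submodule.span ℂ {evalVec 1 Y} :=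
          Submodule.mem_sup_right (Submodule.mem_span_singleton_self _)
        rw [← hY] at this
        exact sup_le_sup_right hmono _ this)
      (by
        refine Submodule.mem_sup_left ?_
        rw [hU'1]
        exact Submodule.mem_sup_right (Submodule.mem_span_singleton_self _))
      (by rw [← hY, hU'1]; exact (sup_right_comm _ _ _).le)
    have hYmem' : ∀ s, evalVec s Y ∈ colSpan s U' (i + 1) ⊔ Submodule.span ℂ {basisVec n j} :=
      fun s => sup_le_sup_right (colSpan_mono s U' (by omega)) _ (hYmem s)
    have hUmem : ∀ s, evalVec s (U' i) ∈ colSpan s U' (i + 1) ⊔ Submodule.span ℂ {basisVec n j} :=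
      fun s => Submodule.mem_sup_left (evalVec_mem_colSpan s U' (by omega))
    -- The coefficients interpolate linearly between (1, 0) at s = 0, which gives the standard
    -- vector, and (α, β) at s = 1, which gives the required step of the flag.
    refine ⟨((1 - Polynomial.X) + Polynomial.C α * Polynomial.X : Polynomial ℂ) • U' i +
        (Polynomial.C β * Polynomial.X : Polynomial ℂ) • Y,
      (Polynomial.C γ : Polynomial ℂ) • U' i + (Polynomial.C δ : Polynomial ℂ) • Y,
      ?_, fun s => ?_, fun a ha => ?_⟩
    · rw [evalVec_add_smul, Polynomial.eval_C, Polynomial.eval_C]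
      exact h2
    · rw [evalVec_add_smul]
      exact Submodule.add_mem _ (Submodule.smul_mem _ _ (hUmem s))
        (Submodule.smul_mem _ _ (hYmem' s))
    · obtain rfl : i = a := by omega
      refine ⟨?_, ?_, fun s => ?_⟩
      · rw [evalVec_add_smul]
        simpa using h1
      · rw [evalVec_add_smul]
        simpa using hU'2
      · rw [evalVec_add_smul]
        exact Submodule.add_mem _ (Submodule.smul_mem _ _ (hUmem s))
          (Submodule.smul_mem _ _ (hYmem' s))

theorem exists_nextColumn {V : PosRoot n → Submodule ℂ (W n)} (hV : V ∈ Rn n) {j : ℕ}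
    (hj : j < n) {U' : ℕ → Fin n → Polynomial ℂ} (hU' : IsColumn V (j + 1) U') :
    ∃ U, IsColumn V j U ∧ IsNextColumn j U' U := by
  -- The entries may be chosen independently for each `a`, as the conditions on `u` involve only `V`
  -- and `U'`, not earlier choices.
  have h := fun a : ℕ => fun ha : a + 1 ≤ j => exists_column_entry hV hj hU' (a + 1) ha
  choose! U Y hUY using h
  refine ⟨U, fun a ha => ?_, fun a ha => ((hUY a ha).2.2 a rfl).2.2⟩
  obtain ⟨h1, h2, h3⟩ := (hUY a ha).2.2 a rfl
  refine ⟨h1, h2, fun s x hax hxj => ?_⟩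
  obtain ⟨p, hp, q, hq, hpq⟩ := Submodule.mem_sup.1 (h3 s)
  have hp0 : p x = 0 := by
    refine apply_eq_zero_of_mem_span x ?_ hp
    rintro _ ⟨b, rfl⟩
    have := b.isLt
    exact (hU' b (by omega)).2.2 s x (by omega) (by omega)
  have hq0 : q x = 0 := by
    refine apply_eq_zero_of_mem_span x ?_ hq
    rintro _ rfl
    exact if_neg (by omega)
  rw [← hpq, Pi.add_apply, hp0, hq0, add_zero]

/-- Every point of `R_n` is a member of a polynomial family of points through a point of the open
cell. -/
theorem exists_curve {V : PosRoot n → Submodule ℂ (W n)} (hV : V ∈ Rn n) :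
    ∃ U : ℕ → ℕ → Fin n → Polynomial ℂ, (∀ j ≤ n, IsColumn V j (U j)) ∧
      ∀ j < n, IsNextColumn j (U (j + 1)) (U j) := by
  -- The construction descends from j = n, where constant standard vectors work, so the sequence is
  -- indexed by d = n - j.
  obtain ⟨f, hf₁, hf₂⟩ := exists_dependent_seq
    (fun d (U : ℕ → Fin n → Polynomial ℂ) => IsColumn V (n - d) U)
    (fun d U' U => d < n → IsNextColumn (n - (d + 1)) U' U)
    ⟨fun a => constVec (basisVec n a), fun a ha => by
      refine ⟨?_, evalVec_constVec _ _, fun s x hax _ => ?_⟩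
      · simp only [Nat.sub_zero, evalVec_constVec, extendedFlag_last]
        have : (Set.range fun b : Fin (a + 1) => basisVec n b) =
            (Set.range fun b : Fin a => basisVec n b) ∪ {basisVec n a} := by
          ext w
          constructor
          · rintro ⟨b, rfl⟩
            rcases Nat.lt_succ_iff_lt_or_eq.1 b.isLt with h | h
            · exact Or.inl ⟨⟨b, h⟩, rfl⟩
            · right
              simp [h]
          · rintro (⟨b, rfl⟩ | rfl)
            · exact ⟨b.castSucc, rfl⟩
            · exact ⟨Fin.last a, rfl⟩
        rw [this, Submodule.span_union]
      · rw [evalVec_constVec]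
        exact if_neg (by omega)⟩
    (fun d U' hU' => by
      by_cases hd : d < n
      · have e : n - d = n - (d + 1) + 1 := by omega
        rw [e] at hU'
        obtain ⟨U, h1, h2⟩ := exists_nextColumn hV (by omega) hU'
        exact ⟨U, h1, fun _ => h2⟩
      · refine ⟨U', fun a ha => absurd ha (by omega), fun h => absurd h hd⟩)
  refine ⟨fun j => f (n - j), fun j hj => ?_, fun j hj => ?_⟩
  · have := hf₁ (n - j)
    rwa [Nat.sub_sub_self hj] at this
  · have := hf₂ (n - (j + 1)) (by omega)
    have e : n - (j + 1) + 1 = n - j := by omega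
    rw [e, Nat.sub_sub_self hj.le] at this
    exact this

theorem extendedFlag_eq_colSpan {V : PosRoot n → Submodule ℂ (W n)} {j : ℕ}
    {U : ℕ → Fin n → Polynomial ℂ} (hU : IsColumn V j U) (i : ℕ) (hi : i ≤ j) :
    extendedFlag V i j = colSpan 1 U i := by
  induction i with
  | zero => rw [extendedFlag_zero, colSpan]; simp
  | succ i ih =>
    rw [(hU i hi).1, ih (by omega)]
    apply le_antisymm
    · refine sup_le (colSpan_mono _ _ (by omega)) ?_
      exact (Submodule.span_singleton_le_iff_mem _ _).2 (evalVec_mem_colSpan _ _ (by omega))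
    · refine colSpan_le fun a ha => ?_
      rcases Nat.lt_succ_iff_lt_or_eq.1 ha with h | rfl
      · exact Submodule.mem_sup_left (evalVec_mem_colSpan _ _ h)
      · exact Submodule.mem_sup_right (Submodule.mem_span_singleton_self _)

/-- The projection condition holds because `IsNextColumn` writes each vector as p plus a multiple of
w_{j+1} with p in the span for j + 1. Since p has zero coordinate at w_{j+1}, it is the projection.
-/
theorem curve_mem_Rn {V : PosRoot n → Submodule ℂ (W n)} {U : ℕ → ℕ → Fin n → Polynomial ℂ}
    (hU : ∀ j ≤ n, IsColumn V j (U j)) (hU' : ∀ j < n, IsNextColumn j (U (j + 1)) (U j)) (s : ℂ)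
    (hs : ∀ r : PosRoot n, LinearIndependent ℂ fun a : Fin r.i => evalVec s (U r.j a)) :
    (fun r : PosRoot n => colSpan s (U r.j) r.i) ∈ Rn n := by
  refine ⟨fun r => ⟨?_, ?_⟩, fun r r' hi hj => ?_, fun r r' hi hj => ?_⟩
  · exact (finrank_span_eq_card (hs r)).trans (Fintype.card_fin _)
  · refine colSpan_le fun a ha => (mem_coordSubspace_iff _ _).2 fun x hx => ?_
    have := r.i_le_j
    rw [InRange, not_or] at hx
    exact (hU r.j r.j_lt.le a (by omega)).2.2 s x (by omega) (by omega)
  · dsimp only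
    rw [hi, hj]
    exact colSpan_mono _ _ (by omega)
  · dsimp only
    rw [hi, hj, Submodule.map_le_iff_le_comap]
    refine colSpan_le fun a ha => ?_
    have hij := r.i_le_j
    obtain ⟨p, hp, q, hq, hpq⟩ := Submodule.mem_sup.1 (hU' r.j r.j_lt a (by omega) s)
    obtain ⟨μ, rfl⟩ := Submodule.mem_span_singleton.1 hq
    have hp0 : p ⟨r.j, r.j_lt⟩ = 0 := by
      refine apply_eq_zero_of_mem_span _ ?_ hp
      rintro _ ⟨b, rfl⟩
      have := b.isLt
      exact (hU (r.j + 1) r.j_lt b (by omega)).2.2 s _ (by simp; omega) (by simp)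
    have hproj : proj ⟨r.j, r.j_lt⟩ (evalVec s (U r.j a)) = p := by
      rw [← hpq]
      ext x
      change Function.update _ _ _ x = _
      by_cases hx : x = ⟨r.j, r.j_lt⟩
      · rw [hx, Function.update_self, hp0]
      · rw [Function.update_of_ne hx]
        have : basisVec n r.j x = 0 := if_neg fun h => hx (Fin.ext h)
        simp [this]
    rw [Submodule.mem_comap, hproj]
    exact colSpan_mono _ _ (by omega) hp

theorem eval_det_curve {m : ℕ} (s : ℂ) (U : ℕ → Fin n → Polynomial ℂ) (L : Fin m → Fin n) :
    (Matrix.of fun a b : Fin m => U a (L b)).det.eval s =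
      (Matrix.of fun a b : Fin m => evalVec s (U a) (L b)).det := by
  have := RingHom.map_det (Polynomial.evalRingHom s) (Matrix.of fun a b : Fin m => U a (L b))
  exact this

/-- A multi-homogeneous polynomial vanishing on the open cell vanishes on `R_n`. -/
theorem vanishesOnRn_of_genericHom {F : PolyRing n} {m : PosRoot n → ℕ}
    (hm : IsMultihomogeneous F m) (hF : genericHom n F = 0) : VanishesOnRn F := by
  intro V hV v hv
  obtain ⟨U, hU, hU'⟩ := exists_curve hV
  let vs : ℂ → (r : PosRoot n) → Fin r.i → W n := fun s r a => evalVec s (U r.j a)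
  let G : Polynomial ℂ := MvPolynomial.aeval
    (fun x : PluckerVar n => (Matrix.of fun a b : Fin x.1.i => U x.1.j a (x.2.1 b)).det) F
  let D : Polynomial ℂ := ∏ r : PosRoot n,
    (Matrix.of fun a b : Fin r.i => U r.j a (Fin.castLE r.i_le b)).det
  have hG : ∀ s, G.eval s = MvPolynomial.eval (pluckerCoord (vs s)) F := by
    intro s
    have : (Polynomial.aeval s : Polynomial ℂ →ₐ[ℂ] ℂ).comp (MvPolynomial.aeval
        (fun x : PluckerVar n => (Matrix.of fun a b : Fin x.1.i => U x.1.j a (x.2.1 b)).det)) =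
        MvPolynomial.aeval (pluckerCoord (vs s)) := by
      apply MvPolynomial.algHom_ext
      intro x
      rw [AlgHom.comp_apply, MvPolynomial.aeval_X, MvPolynomial.aeval_X, Polynomial.coe_aeval_eq_eval,
        eval_det_curve]
      rfl
    have h := DFunLike.congr_fun this F
    rw [AlgHom.comp_apply, Polynomial.coe_aeval_eq_eval, MvPolynomial.aeval_eq_eval] at h
    exact h
  have hD₀ : D ≠ 0 := by
    intro h
    have h0 : D.eval 0 = 1 := by
      simp only [D, Polynomial.eval_prod]
      refine Finset.prod_eq_one fun r _ => ?_
      rw [eval_det_curve]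
      have : (Matrix.of fun a b : Fin r.i => evalVec 0 (U r.j a) (Fin.castLE r.i_le b)) = 1 := by
        ext a b
        have h1 := r.i_le_j
        have h2 := a.isLt
        rw [Matrix.of_apply, (hU r.j r.j_lt.le a (by omega)).2.1]
        simp [basisVec, Matrix.one_apply, Fin.ext_iff, eq_comm]
      rw [this, Matrix.det_one]
    rw [h, Polynomial.eval_zero] at h0
    exact zero_ne_one h0
  -- Where `D` is nonzero the curve lies in the cell, so `G` vanishes there; since `D` is 1 at s =
  -- 0, cancellation gives `G = 0`, in particular at s = 1.
  have hDG : D * G = 0 := by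
    apply Polynomial.funext
    intro s
    rw [Polynomial.eval_mul, Polynomial.eval_zero, mul_eq_zero, or_iff_not_imp_left]
    intro hDs
    have hdet : ∀ r, (Matrix.of fun a b => vs s r a (Fin.castLE r.i_le b)).det ≠ 0 := by
      intro r
      rw [Polynomial.eval_prod] at hDs
      have := Finset.prod_ne_zero_iff.1 hDs r (Finset.mem_univ _)
      rw [eval_det_curve] at this
      exact this
    have hli : ∀ r : PosRoot n, LinearIndependent ℂ (vs s r) := fun r =>
      linearIndependent_of_minor_ne_zero _ _ (hdet r)
    obtain ⟨c, t, hct⟩ := exists_cell_coord (curve_mem_Rn hU hU' s hli) (v := vs s)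
      (fun r => ⟨hli r, rfl⟩) hdet
    have := cellHom_eq_zero hF c t
    rw [cellHom, MvPolynomial.aeval_eq_eval] at this
    rw [hG, hct]
    exact this
  have hG₀ : G = 0 := (mul_eq_zero.1 hDG).resolve_left hD₀
  have hspan : ∀ (r : PosRoot n) (a : Fin r.i), ∃ y : Fin r.i → ℂ, ∑ d, y d • vs 1 r d = v r a := by
    intro r a
    have h1 : v r a ∈ V r := by
      rw [← (hv r).2]; exact Submodule.subset_span ⟨a, rfl⟩
    rw [← extendedFlag_root V r, extendedFlag_eq_colSpan (hU r.j r.j_lt.le) r.i r.i_le_j] at h1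
    exact (Submodule.mem_span_range_iff_exists_fun ℂ).1 h1
  choose T hT using hspan
  -- The given bases differ from those of the curve at s = 1 by matrices `T`, which only rescale the
  -- coordinates in each component; multi-homogeneity absorbs the factors.
  have hcoord : pluckerCoord v =
      fun x : PluckerVar n => (Matrix.of (T x.1)).det * pluckerCoord (vs 1) x := by
    funext x
    rw [pluckerCoord, pluckerCoord, ← Matrix.det_mul]
    congr 1
    ext a b
    rw [Matrix.of_apply, ← hT, Finset.sum_apply, Matrix.mul_apply]
    rfl
  rw [hcoord, eval_scale hm (fun r => (Matrix.of (T r)).det), ← hG, hG₀, Polynomial.eval_zero,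
    mul_zero]

/-- At a fixed cell point the evaluation is a polynomial in the scalings `t`, and the component of
multi-degree `m` contributes exactly the monomial t^m. Vanishing for all `t` forces each coefficient
to vanish. -/
theorem genericHom_component {F : PolyRing n} (hF : genericHom n F = 0) (m : PosRoot n → ℕ) :
    genericHom n (MvPolynomial.weightedHomogeneousComponent
      (fun x : PluckerVar n => (Pi.single x.1 1 : PosRoot n → ℕ)) m F) = 0 := by
  classical
  set w : PluckerVar n → PosRoot n → ℕ := fun x => Pi.single x.1 1 with hw
  refine genericHom_eq_zero fun c t => ?_
  have hhom : ∀ d, IsMultihomogeneous (MvPolynomial.weightedHomogeneousComponent w d F) d := fun d =>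
    MvPolynomial.weightedHomogeneousComponent_isWeightedHomogeneous d F
  let S := (MvPolynomial.weightedHomogeneousComponent_finsupp (w := w) F).toFinset
  have hsum : F = ∑ d ∈ S, MvPolynomial.weightedHomogeneousComponent w d F := by
    conv_lhs => rw [← MvPolynomial.finsum_weightedHomogeneousComponent w F]
    exact finsum_eq_sum _ _
  let p : PluckerVar n → ℂ := fun x => minor c x.1 x.2.1
  let g : MvPolynomial (PosRoot n) ℂ := ∑ d ∈ S, MvPolynomial.monomial
    (Finsupp.equivFunOnFinite.symm d)
    (MvPolynomial.eval p (MvPolynomial.weightedHomogeneousComponent w d F))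
  have hg : g = 0 := by
    apply MvPolynomial.funext
    intro t
    have h0 := cellHom_eq_zero hF c t
    rw [hsum, map_sum] at h0
    rw [map_zero, ← h0, map_sum]
    refine Finset.sum_congr rfl fun d _ => ?_
    rw [cellHom_eq_eval (hhom d), MvPolynomial.eval_monomial, mul_comm, Finsupp.prod_fintype]
    · rfl
    · simp
  by_cases hm : m ∈ S
  · have h1 := congrArg (MvPolynomial.coeff (Finsupp.equivFunOnFinite.symm m)) hg
    rw [MvPolynomial.coeff_sum, Finset.sum_eq_single m] at h1
    · rw [MvPolynomial.coeff_monomial, if_pos rfl, MvPolynomial.coeff_zero] at h1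
      rw [cellHom_eq_eval (hhom m), h1, mul_zero]
    · intro d _ hd
      rw [MvPolynomial.coeff_monomial, if_neg]
      exact fun h => hd (Finsupp.equivFunOnFinite.symm.injective h)
    · exact fun h => absurd hm h
  · have : MvPolynomial.weightedHomogeneousComponent w m F = 0 := by
      by_contra h
      exact hm ((Set.Finite.mem_toFinset _).2 h)
    rw [this, map_zero]

/-- The ideal of `R_n` is the ideal of the open cell. -/
theorem mem_vanishingIdeal_iff (F : PolyRing n) : F ∈ vanishingIdeal n ↔ genericHom n F = 0 := by
  refine ⟨genericHom_of_mem_vanishingIdeal, fun hF => ?_⟩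
  rw [← MvPolynomial.finsum_weightedHomogeneousComponent
    (fun x : PluckerVar n => (Pi.single x.1 1 : PosRoot n → ℕ)) F]
  refine finsum_induction (· ∈ vanishingIdeal n) (Ideal.zero_mem _)
    (fun _ _ hx hy => Ideal.add_mem _ hx hy) fun m => ?_
  refine Ideal.subset_span ⟨⟨m, ?_⟩, ?_⟩
  · exact MvPolynomial.weightedHomogeneousComponent_isWeightedHomogeneous m F
  · exact vanishesOnRn_of_genericHom
      (MvPolynomial.weightedHomogeneousComponent_isWeightedHomogeneous m F)
      (genericHom_component hF m)

end Curve

end DegenerateFlag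

end

theorem theorem3p10 (n : ℕ) :
    (∀ F : DegenerateFlag.PolyRing n,
      F ∈ DegenerateFlag.vanishingIdeal n ↔
        ∃ N : DegenerateFlag.PosRoot n → ℕ,
          (∏ r, DegenerateFlag.topX r ^ N r) * F ∈ DegenerateFlag.pluckerIdeal n) ∧
    (∀ c : DegenerateFlag.NMinus n, ∀ F ∈ DegenerateFlag.vanishingIdeal n,
      DegenerateFlag.nMinusAct c F ∈ DegenerateFlag.vanishingIdeal n) := by
  refine ⟨fun F => ?_, fun c F hF => ?_⟩
  · rw [DegenerateFlag.mem_vanishingIdeal_iff, DegenerateFlag.genericHom_eq_zero_iff]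
  · rw [DegenerateFlag.mem_vanishingIdeal_iff] at hF ⊢
    exact DegenerateFlag.genericHom_nMinusAct hF c
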